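/- Let $d\in\{2,3\}$ and let $\Omega\subset\mathbb{R}^d$ be a bounded open set. Let $W_0^{1,2}(\Omega)^d$ be the closure in $W^{1,2}(\Omega)^d$ of the smooth vector fields with compact support in $\Omega$, with norm $\|\mathbf v\|_{1,2}:=\|\nabla \mathbf v\|_2$, where $(\nabla\mathbf v)_{ij}=\partial_i v_j$, and put $\mathrm D\mathbf v:=\tfrac12(\nabla\mathbf v+(\nabla\mathbf v)^{\mathrm T})$. Matrices carry the Frobenius inner product ":" and norm $|\cdot|$. Let $$\mathcal B[\mathbf v;\mathbf w,\mathbf h]:=\tfrac12\int_\Omega (\mathbf v\otimes\mathbf h):\nabla\mathbf w-(\mathbf v\otimes\mathbf w):\nabla\mathbf h\,\mathrm dx .$$ There is a constant $C_{\mathcal B}>0$ such that $$\mathcal B[\mathbf v;\mathbf w,\mathbf h]\le C_{\mathcal B}\|\mathbf v\|_{1,2}\|\mathbf w\|_{1,2}\|\mathbf h\|_{1,2}\qquad\text{for all }\mathbf v,\mathbf w,\mathbf h\in W_0^{1,2}(\Omega)^d. \tag{1}$$ Let $C_{\mathcal B}>0$ be any constant with (1). Let $\mathcal T$ be a conforming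 triangulation of $\Omega$ into finitely many $d$-simplices ($\Omega$ being the interior of the union of the closed simplices), and, for $K\in\mathcal T$, let $\mathbb P_1^d\subseteq\mathbb P_{\mathbb V}(K)\subseteq\mathbb P_{i^\star}^d$ and $\mathbb P_0\subseteq\mathbb P_{\mathbb Q}(K)\subseteq\mathbb P_{j^\star}$ be vector spaces of polynomials, $i^\star\ge j^\star\ge0$, where $\mathbb P_m$ denotes the polynomials of degree at most $m$. Put $$\mathbb V:=\{\mathbf V\in W_0^{1,2}(\Omega)^d:\mathbf V|_K\in\mathbb P_{\mathbb V}(K)\ \forall K\in\mathcal T\},\qquad \mathbb Q:=\{Q\in L^\infty(\Omega):Q|_K\in\mathbb P_{\mathbb Q}(K)\ \forall K\in\mathcal T\},$$ $$\mathbb V_0:=\Big\{\mathbf V\in\mathbb V:\int_\Omega Q\,\operatorname{div}\mathbf V\,\mathrm dx=0\ \ \forall Q\in\mathbb Q\Big\},\qquad B_R:=\{\mathbf U\in\mathbb V_0:\|\mathrm D\mathbf U\|_2\le R\}.$$ Let $\sigma\ge0$, $\nu>0$, $n\in\{1,2,\dots\}$, $\mathbf f\in L^2(\Omega)^d$, and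 define $\mathbf f(\mathbf V):=\int_\Omega\mathbf f\cdot\mathbf V\,\mathrm dx$ and $$\langle \mathrm F(\mathbf U),\mathbf V\rangle:=\int_\Omega\Big(\frac{\sigma}{\sqrt{|\mathrm D\mathbf U|^2+n^{-2}}}+2\nu\Big)\mathrm D\mathbf U:\mathrm D\mathbf V\,\mathrm dx+\mathcal B[\mathbf U;\mathbf U,\mathbf V]-\mathbf f(\mathbf V).$$ Assume that $$\|\mathbf f\|_\star:=\sup_{\mathbf V\in\mathbb V_0\setminus\{0\}}\frac{\mathbf f(\mathbf V)}{\|\mathrm D\mathbf V\|_2}<\frac{\nu^2}{2\sqrt2\,C_{\mathcal B}}$$ (the supremum being $0$ if $\mathbb V_0=\{0\}$), and let $R>0$ satisfy $$\frac{\nu-\sqrt{\nu^2-2\sqrt2C_{\mathcal B}\|\mathbf f\|_\star}}{2\sqrt2C_{\mathcal B}}\le R\le\frac{\nu+\sqrt{\nu^2-2\sqrt2C_{\mathcal B}\|\mathbf f\|_\star}}{2\sqrt2C_{\mathcal B}} .$$ Put $\nu_{\mathrm F}:=\nu-\sqrt2C_{\mathcal B}R$ and $L_{\mathrm F}:=\sqrt3\,\sigma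 n+2\nu+2\sqrt2C_{\mathcal B}R$. Then: 1. $\nu_{\mathrm F}\ge0$, and $\nu_{\mathrm F}>0$ unless both $\|\mathbf f\|_\star=0$ and $R=\nu/(\sqrt2C_{\mathcal B})$. 2. $\langle\mathrm F(\mathbf U)-\mathrm F(\mathbf V),\mathbf U-\mathbf V\rangle\ge\nu_{\mathrm F}\|\mathbf U-\mathbf V\|_{1,2}^2$ for all $\mathbf U,\mathbf V\in B_R$. 3. $|\langle\mathrm F(\mathbf U)-\mathrm F(\mathbf V),\mathbf W\rangle|\le L_{\mathrm F}\|\mathbf U-\mathbf V\|_{1,2}\|\mathbf W\|_{1,2}$ for all $\mathbf U,\mathbf V\in B_R$ and $\mathbf W\in\mathbb V_0$. 4. There is exactly one $\mathbf U^\ast\in B_R$ with $\langle\mathrm F(\mathbf U^\ast),\mathbf V\rangle=0$ for all $\mathbf V\in\mathbb V_0$. If $0<\delta<2\nu_{\mathrm F}L_{\mathrm F}^{-2}$, then for every $\mathbf U\in\mathbb V_0$ there is exactly one $\mathbf U'\in\mathbb V_0$ with $$\int_\Omega\mathrm D\mathbf U':\mathrm D\mathbf V\,\mathrm dx=\int_\Omega\mathrm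 D\mathbf U:\mathrm D\mathbf V\,\mathrm dx-\delta\langle\mathrm F(\mathbf U),\mathbf V\rangle\qquad\text{for all }\mathbf V\in\mathbb V_0,$$ and the Zarantonello iteration $\mathbf U^{\ell+1}:=(\mathbf U^\ell)'$ converges, for every initial guess $\mathbf U^0\in B_R$, to $\mathbf U^\ast$, i.e. $\|\mathbf U^\ell-\mathbf U^\ast\|_{1,2}\to0$ as $\ell\to\infty$. -/

import Mathlib

open MeasureTheory Filter Topology

noncomputable section

namespace Bingham

/-- The Euclidean space `ℝ^d`. -/
abbrev Vec (d : ℕ) := EuclideanSpace ℝ (Fin d)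

/-- Real `d × d` matrices with the Frobenius inner product and the Frobenius norm. -/
abbrev Mat (d : ℕ) := EuclideanSpace ℝ (Fin d × Fin d)

/-- The gradient `(∇φ)_{ij} = ∂_i φ_j` of a differentiable vector field. -/
def grad {d : ℕ} (φ : Vec d → Vec d) (x : Vec d) : Mat d :=
  WithLp.toLp 2 fun p : Fin d × Fin d => fderiv ℝ φ x (EuclideanSpace.single p.1 1) p.2

/-- Pairs `(u, G)` in `L²(Ω)^d × L²(Ω)^{d × d}`; `W_0^{1,2}(Ω)^d` is realised below as a
space of such pairs, `u` being the function and `G` its weak gradient. -/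
abbrev FieldPair {d : ℕ} (Ω : Set (Vec d)) :=
  Lp (Vec d) 2 (volume.restrict Ω) × Lp (Mat d) 2 (volume.restrict Ω)

/-- The pairs `(φ, ∇φ)` with `φ` smooth and compactly supported in `Ω`. -/
def testPairs {d : ℕ} (Ω : Set (Vec d)) : Submodule ℝ (FieldPair Ω) where
  carrier := {p | ∃ φ : Vec d → Vec d, ContDiff ℝ (⊤ : ℕ∞) φ ∧ HasCompactSupport φ ∧
    tsupport φ ⊆ Ω ∧ p.1 =ᵐ[volume.restrict Ω] φ ∧ p.2 =ᵐ[volume.restrict Ω] grad φ}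
  zero_mem' := by
    refine ⟨0, contDiff_const, HasCompactSupport.zero, by simp, Lp.coeFn_zero _ _ _, ?_⟩
    filter_upwards [Lp.coeFn_zero (Mat d) 2 (volume.restrict Ω)] with x hx
    refine hx.trans ?_
    ext p
    simp [grad]
  add_mem' := by
    rintro p q ⟨φ, hφ, hφc, hφs, hφ1, hφ2⟩ ⟨ψ, hψ, hψc, hψs, hψ1, hψ2⟩
    refine ⟨φ + ψ, hφ.add hψ, hφc.add hψc, (tsupport_add φ ψ).trans (Set.union_subset hφs hψs),
      (Lp.coeFn_add p.1 q.1).trans (hφ1.add hψ1), (Lp.coeFn_add p.2 q.2).trans ?_⟩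
    filter_upwards [hφ2, hψ2] with x h1 h2
    have e : fderiv ℝ (φ + ψ) x = fderiv ℝ φ x + fderiv ℝ ψ x :=
      fderiv_add (hφ.differentiable (by simp) x) (hψ.differentiable (by simp) x)
    rw [Pi.add_apply, h1, h2]
    ext r
    simp [grad, e]
  smul_mem' := by
    rintro c p ⟨φ, hφ, hφc, hφs, hφ1, hφ2⟩
    refine ⟨c • φ, contDiff_const.smul hφ, hφc.smul_left (f := fun _ => c),
      (tsupport_smul_subset_right (fun _ => c) φ).trans hφs,
      (Lp.coeFn_smul c p.1).trans (hφ1.const_smul c), (Lp.coeFn_smul c p.2).trans ?_⟩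
    filter_upwards [hφ2] with x h1
    have e : fderiv ℝ (c • φ) x = c • fderiv ℝ φ x :=
      fderiv_const_smul (hφ.differentiable (by simp) x) c
    rw [Pi.smul_apply, h1]
    ext r
    simp [grad, e]

/-- `W_0^{1,2}(Ω)^d`: the closure of the test fields in the `W^{1,2}`-topology, i.e. the closure
of the pairs `(φ, ∇φ)` in `L² × L²`. An element is a pair `(u, ∇u)`. -/
def sobolevZero {d : ℕ} (Ω : Set (Vec d)) : Submodule ℝ (FieldPair Ω) :=
  (testPairs Ω).topologicalClosure

/-- The symmetric part `(G + Gᵀ) / 2` of a matrix. -/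
def sym {d : ℕ} (G : Mat d) : Mat d :=
  WithLp.toLp 2 fun p : Fin d × Fin d => (G (p.1, p.2) + G (p.2, p.1)) / 2

/-- The symmetric velocity gradient `D u`. -/
def symGrad {d : ℕ} {Ω : Set (Vec d)} (U : FieldPair Ω) (x : Vec d) : Mat d := sym (U.2 x)

/-- `‖U‖_{1,2} = ‖∇U‖_2`, the norm of `W_0^{1,2}(Ω)^d`. -/
def gradNorm {d : ℕ} {Ω : Set (Vec d)} (U : FieldPair Ω) : ℝ :=
  Real.sqrt (∫ x in Ω, ‖U.2 x‖ ^ 2)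

/-- `‖D U‖_2`. -/
def symNorm {d : ℕ} {Ω : Set (Vec d)} (U : FieldPair Ω) : ℝ :=
  Real.sqrt (∫ x in Ω, ‖symGrad U x‖ ^ 2)

/-- `(U, V) = ∫_Ω D U : D V`. -/
def symInner {d : ℕ} {Ω : Set (Vec d)} (U V : FieldPair Ω) : ℝ :=
  ∫ x in Ω, inner ℝ (symGrad U x) (symGrad V x)

/-- The skew-symmetrised convection form
`B[v; w, h] = 1/2 ∫_Ω (v ⊗ h) : ∇w - (v ⊗ w) : ∇h`. -/
def convection {d : ℕ} {Ω : Set (Vec d)} (v w h : FieldPair Ω) : ℝ :=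
  1 / 2 * ∫ x in Ω, ((∑ i, ∑ j, v.1 x i * h.1 x j * w.2 x (i, j)) -
    ∑ i, ∑ j, v.1 x i * w.1 x j * h.2 x (i, j))

/-- `C` is an admissible constant in the bound of the convection form on `W_0^{1,2}(Ω)^d`. -/
def IsConvectionBound {d : ℕ} (Ω : Set (Vec d)) (C : ℝ) : Prop :=
  ∀ v ∈ sobolevZero Ω, ∀ w ∈ sobolevZero Ω, ∀ h ∈ sobolevZero Ω,
    convection v w h ≤ C * gradNorm v * gradNorm w * gradNorm h

/-- A conforming simplicial triangulation of `Ω`: a finite geometric simplicial complex, all of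
whose faces are faces of `d`-simplices, and whose union has interior `Ω`. -/
structure Triangulation {d : ℕ} (Ω : Set (Vec d)) where
  complex : Geometry.SimplicialComplex ℝ (Vec d)
  finite_faces : complex.faces.Finite
  pure : ∀ s ∈ complex.faces, ∃ t ∈ complex.faces, s ⊆ t ∧ t.card = d + 1
  interior_space : interior complex.space = Ω

/-- The elements `K` of the triangulation, given by their vertices. -/
def Triangulation.cells {d : ℕ} {Ω : Set (Vec d)} (T : Triangulation Ω) :
    Set (Finset (Vec d)) :=
  {s | s ∈ T.complex.faces ∧ s.card = d + 1}

/-- The open simplex with the given vertices. -/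
def openCell {d : ℕ} (K : Finset (Vec d)) : Set (Vec d) :=
  interior (convexHull ℝ (K : Set (Vec d)))

/-- Local polynomial spaces `ℙ_1^d ⊆ ℙ_𝕍(K) ⊆ ℙ_i^d` for the velocity and
`ℙ_0 ⊆ ℙ_ℚ(K) ⊆ ℙ_j` for the pressure, with `i ≥ j ≥ 0`. -/
structure LocalSpaces {d : ℕ} {Ω : Set (Vec d)} (T : Triangulation Ω) where
  velDeg : ℕ
  presDeg : ℕ
  presDeg_le : presDeg ≤ velDeg
  vel : Finset (Vec d) → Submodule ℝ (Fin d → MvPolynomial (Fin d) ℝ)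
  pres : Finset (Vec d) → Submodule ℝ (MvPolynomial (Fin d) ℝ)
  le_vel : ∀ K ∈ T.cells, ∀ P : Fin d → MvPolynomial (Fin d) ℝ,
    (∀ k, (P k).totalDegree ≤ 1) → P ∈ vel K
  vel_le : ∀ K ∈ T.cells, ∀ P ∈ vel K, ∀ k, (P k).totalDegree ≤ velDeg
  le_pres : ∀ K ∈ T.cells, ∀ P : MvPolynomial (Fin d) ℝ, P.totalDegree ≤ 0 → P ∈ pres K
  pres_le : ∀ K ∈ T.cells, ∀ P ∈ pres K, P.totalDegree ≤ presDeg

/-- The velocity space `𝕍(T) = {V ∈ W_0^{1,2}(Ω)^d : V|_K ∈ ℙ_𝕍(K) for all K}`. -/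
def velocitySpace {d : ℕ} {Ω : Set (Vec d)} {T : Triangulation Ω} (S : LocalSpaces T) :
    Set (FieldPair Ω) :=
  {V | V ∈ sobolevZero Ω ∧ ∀ K ∈ T.cells, ∃ P ∈ S.vel K,
    ∀ᵐ x ∂(volume.restrict (openCell K)),
      V.1 x = WithLp.toLp 2 fun k => MvPolynomial.eval (fun l => x l) (P k)}

/-- The pressure space `ℚ(T) = {Q ∈ L^∞(Ω) : Q|_K ∈ ℙ_ℚ(K) for all K}`. -/
def pressureSpace {d : ℕ} {Ω : Set (Vec d)} {T : Triangulation Ω} (S : LocalSpaces T) :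
    Set (Lp ℝ ⊤ (volume.restrict Ω)) :=
  {Q | ∀ K ∈ T.cells, ∃ P ∈ S.pres K,
    ∀ᵐ x ∂(volume.restrict (openCell K)), Q x = MvPolynomial.eval (fun l => x l) P}

/-- The discretely divergence-free space
`𝕍_0(T) = {V ∈ 𝕍(T) : ∫_Ω Q div V = 0 for all Q ∈ ℚ(T)}`. -/
def divFreeSpace {d : ℕ} {Ω : Set (Vec d)} {T : Triangulation Ω} (S : LocalSpaces T) :
    Set (FieldPair Ω) :=
  {V | V ∈ velocitySpace S ∧ ∀ Q ∈ pressureSpace S, ∫ x in Ω, Q x * ∑ i, V.2 x (i, i) = 0}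

/-- The regularised Bercovier-Engelman viscosity `σ / |κ|_n + 2 ν`,
with `|κ|_n = √(|κ|² + n⁻²)`. -/
def viscosity {d : ℕ} (σ ν : ℝ) (n : ℕ) (κ : Mat d) : ℝ :=
  σ / Real.sqrt (‖κ‖ ^ 2 + ((n : ℝ) ^ 2)⁻¹) + 2 * ν

/-- `a_n(U; V, W) = ∫_Ω (σ / |D U|_n + 2 ν) D V : D W`. -/
def viscousForm {d : ℕ} {Ω : Set (Vec d)} (σ ν : ℝ) (n : ℕ) (U V W : FieldPair Ω) : ℝ :=
  ∫ x in Ω, viscosity σ ν n (symGrad U x) * inner ℝ (symGrad V x) (symGrad W x)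

/-- `f(V) = ∫_Ω f · V`. -/
def load {d : ℕ} {Ω : Set (Vec d)} (f : Lp (Vec d) 2 (volume.restrict Ω))
    (V : FieldPair Ω) : ℝ :=
  ∫ x in Ω, inner ℝ (f x) (V.1 x)

/-- `‖f‖_*`, the supremum of `f(V) / ‖D V‖_2` over the nonzero `V ∈ 𝕍_0(T)`. -/
def loadNorm {d : ℕ} {Ω : Set (Vec d)} {T : Triangulation Ω} (S : LocalSpaces T)
    (f : Lp (Vec d) 2 (volume.restrict Ω)) : ℝ :=
  sSup {c | ∃ V ∈ divFreeSpace S, V ≠ 0 ∧ c = load f V / symNorm V}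

/-- The duality pairing `⟨F(U), V⟩ = a_n(U; U, V) + B[U; U, V] - f(V)` of the discrete Bingham
operator with convection. -/
def binghamOp {d : ℕ} {Ω : Set (Vec d)} (σ ν : ℝ) (n : ℕ)
    (f : Lp (Vec d) 2 (volume.restrict Ω)) (U V : FieldPair Ω) : ℝ :=
  viscousForm σ ν n U U V + convection U U V - load f V

/-- The closed ball `{U ∈ 𝕍_0(T) : ‖D U‖_2 ≤ R}`. -/
def ball {d : ℕ} {Ω : Set (Vec d)} {T : Triangulation Ω} (S : LocalSpaces T) (R : ℝ) :
    Set (FieldPair Ω) :=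
  {U | U ∈ divFreeSpace S ∧ symNorm U ≤ R}

/-- `U'` is the Zarantonello iterate `U - δ J⁻¹ F(U)`, where `J` is the Riesz isomorphism of
`𝕍_0(T)` with the inner product `∫_Ω D U : D V`; that is, `U' ∈ 𝕍_0(T)` and
`J U' = J U - δ F(U)` in the dual of `𝕍_0(T)`. -/
def IsZarantonelloStep {d : ℕ} {Ω : Set (Vec d)} {T : Triangulation Ω} (S : LocalSpaces T)
    (σ ν : ℝ) (n : ℕ) (f : Lp (Vec d) 2 (volume.restrict Ω)) (δ : ℝ)
    (U U' : FieldPair Ω) : Prop :=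
  U' ∈ divFreeSpace S ∧ ∀ V ∈ divFreeSpace S,
    symInner U' V = symInner U V - δ * binghamOp σ ν n f U V

end Bingham

end

/-! Let `β = √2 * C`, `a = σ * n`, and let F be the dual norm of the load. Poincaré's and Korn's
inequalities make the symmetric gradient injective with closed range on the discretely
divergence-free space. Its range is therefore a Hilbert space H in which the Riesz map of the
Zarantonello step is the identity, and the problem reads A u + b(u,u) = g. Here A is strongly
monotone with constant 2ν and Lipschitz with constant a + 2ν, b(w,u) is orthogonal to u, and
|b(u,v)| ≤ 2β|u||v|.

Solvability needs no compactness. For frozen w the map A + b(w,·) is still strongly monotone, so A u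
+ b(w,u) = g has a solution S w with |S w| ≤ |g|/(2ν). Small data make S a contraction, and the
solutions are exactly its fixed points. The interval prescribed for R means F ≤ 2R(ν - βR); this
places the solution z in the ball.

Convergence is not a contraction argument on the ball. Invariance of the ball under the step is
never shown, and the Lipschitz constant available on it in the norm of H, a + 2ν + 4βR, may exceed
L_F. Instead, iterates are compared with z alone. Skewness gives monotonicity relative to z with
constant 2(ν - β|z|) for every u, and as long as the distance to z does not grow, |u| ≤ |u₀ - z| +
|z| ≤ R + 2|z| bounds the Lipschitz constant by a + 2ν + 2βR + 6β|z|. The a priori bound makes |z|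
so small that the scalar inequality `step_size_aux` converts δ < 2ν_F/L_F² into a strict decrease of
the distance to z, closing the induction.

Strong monotonicity and Lipschitz continuity in the gradient norm follow directly from pointwise
properties of the stress, Korn's inequality and the bound on the convection form. -/

namespace Bingham

/-! ### Monotone operators with skew convection in a Hilbert space -/

section Hilbert

variable {H : Type*} [NormedAddCommGroup H] [InnerProductSpace ℝ H]

/-- A damped step along a strongly monotone, Lipschitz increment `G` contracts `E`. -/
theorem norm_sub_smul_le {E G : H} {M K δ : ℝ} (hδ : 0 ≤ δ)
    (hM : M * ‖E‖ ^ 2 ≤ inner ℝ G E) (hG : ‖G‖ ≤ K * ‖E‖) :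
    ‖E - δ • G‖ ≤ √(1 - 2 * δ * M + δ ^ 2 * K ^ 2) * ‖E‖ := by
  have h1 : ‖E - δ • G‖ ^ 2 = ‖E‖ ^ 2 - 2 * δ * inner ℝ G E + δ ^ 2 * ‖G‖ ^ 2 := by
    rw [norm_sub_sq_real, inner_smul_right, norm_smul, mul_pow, Real.norm_eq_abs, sq_abs,
      real_inner_comm]
    ring
  have h2 : ‖G‖ ^ 2 ≤ K ^ 2 * ‖E‖ ^ 2 := by
    rw [← mul_pow]
    exact pow_le_pow_left₀ (norm_nonneg _) hG 2
  have h3 : ‖E - δ • G‖ ^ 2 ≤ (1 - 2 * δ * M + δ ^ 2 * K ^ 2) * ‖E‖ ^ 2 := by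
    have h4 := mul_le_mul_of_nonneg_left hM hδ
    have h5 := mul_le_mul_of_nonneg_left h2 (sq_nonneg δ)
    rw [h1]
    linarith
  have h6 := Real.abs_le_sqrt h3
  rwa [abs_of_nonneg (norm_nonneg _), Real.sqrt_mul' _ (sq_nonneg _),
    Real.sqrt_sq (norm_nonneg _)] at h6

/-- Zarantonello: a strongly monotone Lipschitz map of a Hilbert space has a zero. -/
theorem exists_zero_of_strongly_monotone [CompleteSpace H] {T : H → H} {m L : ℝ}
    (hm : 0 < m) (hL : 0 < L)
    (hmono : ∀ u v, m * ‖u - v‖ ^ 2 ≤ inner ℝ (T u - T v) (u - v))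
    (hlip : ∀ u v, ‖T u - T v‖ ≤ L * ‖u - v‖) : ∃ u, T u = 0 := by
  -- This δ minimises 1 - 2δm + δ²L²; the squared contraction factor becomes 1 - m²/L².
  set δ : ℝ := m / L ^ 2 with hδ
  have hδ0 : 0 < δ := by positivity
  set q : ℝ := √(1 - 2 * δ * m + δ ^ 2 * L ^ 2)
  have hq1 : q < 1 := by
    rw [Real.sqrt_lt' one_pos]
    have : δ * L ^ 2 = m := by rw [hδ]; field_simp
    nlinarith [mul_pos hδ0 hm]
  have hcon : ContractingWith ⟨q, Real.sqrt_nonneg _⟩ fun u => u - δ • T u := by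
    refine ⟨by exact_mod_cast hq1, LipschitzWith.of_dist_le_mul fun u v => ?_⟩
    rw [dist_eq_norm, dist_eq_norm]
    have := norm_sub_smul_le hδ0.le (hmono u v) (hlip u v)
    have e : u - δ • T u - (v - δ • T v) = u - v - δ • (T u - T v) := by
      rw [smul_sub]
      abel
    rw [e]
    exact this
  refine ⟨hcon.fixedPoint, ?_⟩
  have h := hcon.fixedPoint_isFixedPt
  rw [Function.IsFixedPt, sub_eq_self, smul_eq_zero] at h
  exact h.resolve_left hδ0.ne'

/-- The iterates of a map that contracts distances to `z` on a ball around `z` converge to `z`. -/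
theorem tendsto_of_contracts_to {H : Type*} [NormedAddCommGroup H] {z : H} {q ρ : ℝ} (hq0 : 0 ≤ q) (hq : q < 1) {u : ℕ → H}
    (h0 : ‖u 0 - z‖ ≤ ρ)
    (hu : ∀ l, ‖u l - z‖ ≤ ρ → ‖u (l + 1) - z‖ ≤ q * ‖u l - z‖) :
    Tendsto (fun l => ‖u l - z‖) atTop (𝓝 0) := by
  have key : ∀ l, ‖u l - z‖ ≤ ρ ∧ ‖u l - z‖ ≤ q ^ l * ‖u 0 - z‖ := by
    intro l
    induction l with
    | zero => simpa using h0
    | succ l ih =>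
      have h := hu l ih.1
      refine ⟨h.trans (le_trans ?_ ih.1), h.trans ?_⟩
      · exact mul_le_of_le_one_left (norm_nonneg _) hq.le
      · rw [pow_succ', mul_assoc]
        exact mul_le_mul_of_nonneg_left ih.2 hq0
  refine squeeze_zero (fun _ => norm_nonneg _) (fun l => (key l).2) ?_
  simpa using (tendsto_pow_atTop_nhds_zero_of_lt_one hq0 hq).mul_const ‖u 0 - z‖

/-- The structure of a monotone operator with skew-symmetric convection: the nonlinear operator is
`u ↦ A u + b u u - f`. -/
structure ConvectiveOperator (A : H → H) (b : H → H → H) (ν a β : ℝ) : Prop where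
  nu_pos : 0 < ν
  a_nonneg : 0 ≤ a
  beta_pos : 0 < β
  mono : ∀ u v, 2 * ν * ‖u - v‖ ^ 2 ≤ inner ℝ (A u - A v) (u - v)
  lip : ∀ u v, ‖A u - A v‖ ≤ (a + 2 * ν) * ‖u - v‖
  map_zero : A 0 = 0
  sub_left : ∀ u v w, b (u - v) w = b u w - b v w
  sub_right : ∀ u v w, b u (v - w) = b u v - b u w
  skew : ∀ u v, inner ℝ (b u v) v = 0
  bound : ∀ u v, ‖b u v‖ ≤ 2 * β * ‖u‖ * ‖v‖

namespace ConvectiveOperator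

variable {A : H → H} {b : H → H → H} {ν a β : ℝ} (h : ConvectiveOperator A b ν a β)
include h

/-- Testing with u removes the convection, so the bound is independent of w. For w = u it is the a
priori bound on solutions. -/
theorem bound_frozen {f w u : H} (hu : A u + b w u - f = 0) : 2 * ν * ‖u‖ ≤ ‖f‖ := by
  have h1 := h.mono u 0
  have h2 : A u = f - b w u := by rw [← sub_eq_zero, ← hu]; abel
  rw [h.map_zero, sub_zero, sub_zero, h2, inner_sub_left, h.skew, sub_zero] at h1
  have h3 := h1.trans (real_inner_le_norm f u)
  rcases (norm_nonneg u).eq_or_lt with h0 | h0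
  · rw [← h0]; simp
  · refine le_of_mul_le_mul_right ?_ h0
    linarith

/-- In the difference of the two equations, b(w₂, u₁ - u₂) vanishes when tested with u₁ - u₂. What
remains is b(w₁ - w₂, u₁), with u₁ controlled by the a priori bound. -/
theorem frozen_diff {f w₁ w₂ u₁ u₂ : H} (h₁ : A u₁ + b w₁ u₁ - f = 0)
    (h₂ : A u₂ + b w₂ u₂ - f = 0) : 2 * ν ^ 2 * ‖u₁ - u₂‖ ≤ β * ‖f‖ * ‖w₁ - w₂‖ := by
  have e1 : A u₁ - A u₂ = - b (w₁ - w₂) u₁ - b w₂ (u₁ - u₂) := by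
    have e3 : A u₁ = f - b w₁ u₁ := by rw [← sub_eq_zero, ← h₁]; abel
    have e4 : A u₂ = f - b w₂ u₂ := by rw [← sub_eq_zero, ← h₂]; abel
    rw [e3, e4, h.sub_left, h.sub_right]
    abel
  have h1 := h.mono u₁ u₂
  rw [e1, inner_sub_left, h.skew, sub_zero] at h1
  have h3 := h1.trans (real_inner_le_norm _ _)
  rw [norm_neg] at h3
  have h4 := h.bound (w₁ - w₂) u₁
  have h5 := h.bound_frozen h₁
  have hν := h.nu_pos
  have hβ := h.beta_pos
  rcases (norm_nonneg (u₁ - u₂)).eq_or_lt with h0 | h0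
  · rw [← h0]; simp only [mul_zero]; positivity
  · have h6 : 2 * ν * ‖u₁ - u₂‖ ≤ 2 * β * ‖w₁ - w₂‖ * ‖u₁‖ := by
      refine le_of_mul_le_mul_right ?_ h0
      nlinarith
    have h7 := mul_le_mul_of_nonneg_left h6 hν.le
    have h8 := mul_le_mul_of_nonneg_left h5 (mul_nonneg hβ.le (norm_nonneg (w₁ - w₂)))
    linarith

/-- The term b(w,·) is skew, so it affects only the Lipschitz constant and leaves the monotonicity
constant 2ν intact, however large w is. -/
theorem exists_frozen [CompleteSpace H] (f w : H) : ∃ u, A u + b w u - f = 0 := by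
  have hν := h.nu_pos
  have ha := h.a_nonneg
  have hβ := h.beta_pos
  have e : ∀ u v, A u + b w u - f - (A v + b w v - f) = A u - A v + b w (u - v) := by
    intro u v
    rw [h.sub_right]
    abel
  refine exists_zero_of_strongly_monotone (T := fun u => A u + b w u - f) (m := 2 * ν)
    (L := a + 2 * ν + 2 * β * ‖w‖) (by positivity) (by positivity) (fun u v => ?_) fun u v => ?_
  · rw [e, inner_add_left, h.skew, add_zero]
    exact h.mono u v
  · rw [e, add_mul]
    exact (norm_add_le _ _).trans (add_le_add (h.lip u v) (h.bound _ _))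

/-- Unique solvability for small data. -/
theorem existsUnique_zero [CompleteSpace H] {f : H} (hf : β * ‖f‖ < 2 * ν ^ 2) :
    ∃! u, A u + b u u - f = 0 := by
  have hν := h.nu_pos
  have hβ := h.beta_pos
  choose S hS using h.exists_frozen f
  set q : ℝ := β * ‖f‖ / (2 * ν ^ 2) with hq
  have hq1 : q < 1 := by rw [hq, div_lt_one (by positivity)]; exact hf
  have hcon : ContractingWith ⟨q, by positivity⟩ S := by
    refine ⟨by exact_mod_cast hq1, LipschitzWith.of_dist_le_mul fun u v => ?_⟩
    rw [dist_eq_norm, dist_eq_norm]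
    have := h.frozen_diff (hS u) (hS v)
    change _ ≤ q * _
    rw [hq, div_mul_eq_mul_div, le_div_iff₀ (by positivity)]
    linarith
  refine ⟨hcon.fixedPoint, ?_, fun u hu => ?_⟩
  · have e : S hcon.fixedPoint = hcon.fixedPoint := hcon.fixedPoint_isFixedPt
    have := hS hcon.fixedPoint
    rwa [e] at this
  · have h2 := h.frozen_diff hu (hS hcon.fixedPoint)
    have e : S hcon.fixedPoint = hcon.fixedPoint := hcon.fixedPoint_isFixedPt
    rw [e] at h2
    have h3 : ‖u - hcon.fixedPoint‖ ≤ 0 := by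
      by_contra h4
      push Not at h4
      have := mul_lt_mul_of_pos_right hf h4
      linarith
    exact sub_eq_zero.1 (norm_le_zero_iff.1 h3)

theorem sub_eq (f u z : H) (hz : A z + b z z - f = 0) :
    A u + b u u - f = A u - A z + b (u - z) z + b u (u - z) := by
  have e : A z = f - b z z := by rw [← sub_eq_zero, ← hz]; abel
  rw [h.sub_left, h.sub_right, e]
  abel

/-- In the expansion around z, the term b(u, u - z) is orthogonal to u - z. Only the size of z
enters, so the estimate holds for all u and not just on a ball. -/
theorem inner_sub_zero_ge {f u z : H} (hz : A z + b z z - f = 0) :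
    2 * (ν - β * ‖z‖) * ‖u - z‖ ^ 2 ≤ inner ℝ (A u + b u u - f) (u - z) := by
  rw [h.sub_eq f u z hz, inner_add_left, inner_add_left, h.skew, add_zero]
  have h1 := h.mono u z
  have h2 := neg_le_of_abs_le (abs_real_inner_le_norm (b (u - z) z) (u - z))
  have h3 := mul_le_mul_of_nonneg_right (h.bound (u - z) z) (norm_nonneg (u - z))
  nlinarith

theorem norm_sub_zero_le {f u z : H} (hz : A z + b z z - f = 0) :
    ‖A u + b u u - f‖ ≤ (a + 2 * ν + 2 * β * ‖z‖ + 2 * β * ‖u‖) * ‖u - z‖ := by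
  rw [h.sub_eq f u z hz]
  refine (norm_add₃_le).trans ?_
  have h1 := h.lip u z
  have h2 := h.bound (u - z) z
  have h3 := h.bound u (u - z)
  linarith

end ConvectiveOperator

end Hilbert

/-! ### The scalar inequality for the step size and convergence of the iteration -/

theorem step_size_poly {x : ℝ} (hx : 0 ≤ x) :
    (1 - x) * (1 + 4 * x - 3 * x ^ 2) ^ 2 ≤ 2 * (1 - x + x ^ 2) * (1 + x) ^ 2 := by
  -- On [0, 1] the difference of the two sides has a small positive minimum (about 0.06) near x =
  -- 7/25, hence squares centred there.
  nlinarith [mul_nonneg hx (sq_nonneg ((x - 7 / 25) * (x - 36 / 25))),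
    mul_nonneg hx (sq_nonneg (x - 7 / 25)), sq_nonneg (x - 7 / 25)]

/-- The scalar inequality behind the admissible step sizes of the Zarantonello iteration. -/
theorem step_size_aux {ν r s a : ℝ} (hν : 0 < ν) (hr : 0 < r) (hrν : r < ν) (hs : 0 ≤ s)
    (hsr : s * ν ≤ r * (ν - r)) (ha : 0 ≤ a) :
    (ν - r) * (a + 2 * ν + 2 * r + 6 * s) ^ 2 ≤ 2 * (ν - s) * (a + 2 * ν + 2 * r) ^ 2 := by
  obtain ⟨x, rfl⟩ : ∃ x, r = x * ν := ⟨r / ν, by field_simp⟩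
  have hx : 0 < x := pos_of_mul_pos_left hr hν.le
  have hx1 : x < 1 := by
    by_contra hc
    nlinarith
  have hsx : s ≤ x * (1 - x) * ν := by
    refine le_of_mul_le_mul_right ?_ hν
    linarith
  -- The case a = 0. The left side grows and the right side falls with s, so the extreme value s =
  -- x(1 - x)ν suffices; dividing by ν³ then leaves a polynomial in x.
  have h1 : (ν - x * ν) * (ν + x * ν + 3 * s) ^ 2 ≤ 2 * (ν - s) * (ν + x * ν) ^ 2 := by
    calc (ν - x * ν) * (ν + x * ν + 3 * s) ^ 2
        ≤ (ν - x * ν) * (ν + x * ν + 3 * (x * (1 - x) * ν)) ^ 2 := by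
          have : 0 ≤ ν - x * ν := by linarith
          gcongr
      _ = ν ^ 3 * ((1 - x) * (1 + 4 * x - 3 * x ^ 2) ^ 2) := by ring
      _ ≤ ν ^ 3 * (2 * (1 - x + x ^ 2) * (1 + x) ^ 2) :=
          mul_le_mul_of_nonneg_left (step_size_poly hx.le) (by positivity)
      _ = 2 * (ν - x * (1 - x) * ν) * (ν + x * ν) ^ 2 := by ring
      _ ≤ 2 * (ν - s) * (ν + x * ν) ^ 2 := by gcongr
  set P : ℝ := 2 * (ν + x * ν) with hP
  have hP0 : 0 < P := by positivity
  -- This says (a + P + 6s)/(a + P) ≤ (P + 6s)/P: a positive a only helps, which reduces the claim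
  -- to a = 0.
  have h2 : (a + P + 6 * s) * P ≤ (a + P) * (P + 6 * s) := by nlinarith [mul_nonneg ha hs]
  have h3 : ((a + P + 6 * s) * P) ^ 2 ≤ ((a + P) * (P + 6 * s)) ^ 2 :=
    pow_le_pow_left₀ (by positivity) h2 2
  have h4 : (ν - x * ν) * ((a + P + 6 * s) * P) ^ 2 ≤
      (ν - x * ν) * ((a + P) * (P + 6 * s)) ^ 2 :=
    mul_le_mul_of_nonneg_left h3 (by linarith)
  have h5 : (a + P) ^ 2 * ((ν - x * ν) * (P + 6 * s) ^ 2) ≤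
      (a + P) ^ 2 * (2 * (ν - s) * P ^ 2) := by
    refine mul_le_mul_of_nonneg_left ?_ (sq_nonneg _)
    rw [hP]
    linarith
  have h6 : a + 2 * ν + 2 * (x * ν) = a + P := by rw [hP]; ring
  rw [h6]
  refine le_of_mul_le_mul_right ?_ (pow_pos hP0 2)
  linarith

/-- Convergence of the Zarantonello iteration for the admissible step sizes. -/
theorem ConvectiveOperator.tendsto_iterate {H : Type*} [NormedAddCommGroup H]
    [InnerProductSpace ℝ H] {A : H → H} {b : H → H → H} {ν a β : ℝ}
    (h : ConvectiveOperator A b ν a β) {f z : H} {F R δ L : ℝ} (hf : ‖f‖ ≤ F)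
    (hz : A z + b z z - f = 0) (hzR : ‖z‖ ≤ R) (hR : 0 < R) (hRν : β * R < ν)
    (hFR : β * F ≤ 2 * (β * R * (ν - β * R))) (hL : a + 2 * ν + 2 * (β * R) ≤ L)
    (hδ : 0 < δ) (hδL : δ < 2 * (ν - β * R) / L ^ 2) {u : ℕ → H} (hu0 : ‖u 0‖ ≤ R)
    (hu : ∀ l, u (l + 1) = u l - δ • (A (u l) + b (u l) (u l) - f)) :
    Tendsto (fun l => ‖u l - z‖) atTop (𝓝 0) := by
  have hν := h.nu_pos
  have hβ := h.beta_pos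
  have ha := h.a_nonneg
  have hz' : 2 * ν * ‖z‖ ≤ F := (h.bound_frozen hz).trans hf
  have hs : β * ‖z‖ * ν ≤ β * R * (ν - β * R) := by
    have := mul_le_mul_of_nonneg_left hz' hβ.le
    linarith
  have hsν : β * ‖z‖ < ν := by
    refine lt_of_le_of_lt ?_ hRν
    exact mul_le_mul_of_nonneg_left hzR hβ.le
  -- The Lipschitz constant relative to z, namely a + 2ν + 2β‖z‖ + 2β‖u‖, evaluated at the largest
  -- norm ‖u‖ ≤ R + 2‖z‖ allowed while the distance to z stays below its initial value.
  set K : ℝ := a + 2 * ν + 2 * (β * R) + 6 * (β * ‖z‖) with hK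
  set M : ℝ := 2 * (ν - β * ‖z‖) with hM
  have hM0 : 0 < M := by rw [hM]; linarith
  have hK0 : 0 < K := by positivity
  have hL0 : 0 < L := lt_of_lt_of_le (by positivity) hL
  -- For δ > 0 this is equivalent to 1 - 2δM + δ²K² < 1.
  have hstep : δ * K ^ 2 < 2 * M := by
    have h1 := step_size_aux hν (mul_pos hβ hR) hRν (by positivity) hs ha
    rw [← hK, ← hM] at h1
    have h2 : M * (a + 2 * ν + 2 * (β * R)) ^ 2 ≤ M * L ^ 2 := by gcongr
    rw [lt_div_iff₀ (by positivity)] at hδL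
    have h3 : δ * L ^ 2 * K ^ 2 < 2 * (ν - β * R) * K ^ 2 :=
      mul_lt_mul_of_pos_right hδL (by positivity)
    refine lt_of_mul_lt_mul_right ?_ (sq_nonneg L)
    linarith
  refine tendsto_of_contracts_to (q := √(1 - 2 * δ * M + δ ^ 2 * K ^ 2)) (Real.sqrt_nonneg _) ?_
    le_rfl fun l hl => ?_
  · rw [Real.sqrt_lt' one_pos]
    nlinarith
  · have e : u (l + 1) - z = u l - z - δ • (A (u l) + b (u l) (u l) - f) := by
      rw [hu]
      abel
    rw [e]
    refine norm_sub_smul_le hδ.le (h.inner_sub_zero_ge hz) ?_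
    refine (h.norm_sub_zero_le hz).trans (mul_le_mul_of_nonneg_right ?_ (norm_nonneg _))
    have h1 : ‖u l‖ ≤ R + 2 * ‖z‖ := by
      have h2 : ‖u l‖ ≤ ‖u l - z‖ + ‖z‖ := norm_le_norm_sub_add _ _
      have h3 : ‖u 0 - z‖ ≤ ‖u 0‖ + ‖z‖ := norm_sub_le _ _
      linarith
    have h4 := mul_le_mul_of_nonneg_left h1 hβ.le
    rw [hK]
    linarith

end Bingham

namespace Bingham

/-! ### Pointwise monotonicity and Lipschitz continuity of the stress -/

section Pointwise

variable {E : Type*} [NormedAddCommGroup E] [InnerProductSpace ℝ E]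

/-- Cauchy–Schwarz for the vectors (x, √e) and (y, √e) in E × ℝ. -/
theorem inner_add_le_sqrt_mul_sqrt {e : ℝ} (he : 0 < e) (x y : E) :
    inner ℝ x y + e ≤ √(‖x‖ ^ 2 + e) * √(‖y‖ ^ 2 + e) := by
  rw [← Real.sqrt_mul (by positivity)]
  refine Real.le_sqrt_of_sq_le ?_
  have h1 := abs_real_inner_le_norm x y
  have h2 : inner ℝ x y ^ 2 ≤ ‖x‖ ^ 2 * ‖y‖ ^ 2 := by
    rw [← sq_abs, ← mul_pow]
    exact pow_le_pow_left₀ (abs_nonneg _) h1 2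
  have h3 := (le_abs_self _).trans h1
  nlinarith [sq_nonneg (‖x‖ - ‖y‖)]

/-- The regularised normalisation `x / √(|x|² + e)` is monotone. -/
theorem inner_normalize_sub_nonneg {e : ℝ} (he : 0 < e) (x y : E) :
    0 ≤ inner ℝ ((√(‖x‖ ^ 2 + e))⁻¹ • x - (√(‖y‖ ^ 2 + e))⁻¹ • y) (x - y) := by
  have hab := inner_add_le_sqrt_mul_sqrt he x y
  have ha2 : √(‖x‖ ^ 2 + e) ^ 2 = ‖x‖ ^ 2 + e := Real.sq_sqrt (by positivity)
  have hb2 : √(‖y‖ ^ 2 + e) ^ 2 = ‖y‖ ^ 2 + e := Real.sq_sqrt (by positivity)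
  have ha : 0 < √(‖x‖ ^ 2 + e) := Real.sqrt_pos.2 (by positivity)
  have hb : 0 < √(‖y‖ ^ 2 + e) := Real.sqrt_pos.2 (by positivity)
  set a := √(‖x‖ ^ 2 + e)
  set b := √(‖y‖ ^ 2 + e)
  have h : inner ℝ (a⁻¹ • x - b⁻¹ • y) (x - y) =
      (a + b) * (a * b - (inner ℝ x y + e)) / (a * b) := by
    simp only [inner_sub_left, inner_sub_right, real_inner_smul_left, real_inner_self_eq_norm_sq,
      real_inner_comm x y]
    have h1 : ‖x‖ ^ 2 = a ^ 2 - e := by rw [ha2]; ring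
    have h2 : ‖y‖ ^ 2 = b ^ 2 - e := by rw [hb2]; ring
    rw [h1, h2]
    field_simp
    ring
  rw [h]
  have : 0 ≤ a * b - (inner ℝ x y + e) := by linarith
  positivity

/-- The regularised normalisation `x / √(|x|² + e)` is Lipschitz with constant `1 / √e`. -/
theorem norm_normalize_sub_le {e : ℝ} (he : 0 < e) (x y : E) :
    ‖(√(‖x‖ ^ 2 + e))⁻¹ • x - (√(‖y‖ ^ 2 + e))⁻¹ • y‖ ≤ (√e)⁻¹ * ‖x - y‖ := by
  have hab := inner_add_le_sqrt_mul_sqrt he x y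
  have ha2 : √(‖x‖ ^ 2 + e) ^ 2 = ‖x‖ ^ 2 + e := Real.sq_sqrt (by positivity)
  have hb2 : √(‖y‖ ^ 2 + e) ^ 2 = ‖y‖ ^ 2 + e := Real.sq_sqrt (by positivity)
  have ha : 0 < √(‖x‖ ^ 2 + e) := Real.sqrt_pos.2 (by positivity)
  have hb : 0 < √(‖y‖ ^ 2 + e) := Real.sqrt_pos.2 (by positivity)
  have hae : √e ≤ √(‖x‖ ^ 2 + e) := Real.sqrt_le_sqrt (by nlinarith [sq_nonneg ‖x‖])
  have hbe : √e ≤ √(‖y‖ ^ 2 + e) := Real.sqrt_le_sqrt (by nlinarith [sq_nonneg ‖y‖])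
  have he2 : √e ^ 2 = e := Real.sq_sqrt he.le
  have hs : 0 < √e := Real.sqrt_pos.2 he
  set a := √(‖x‖ ^ 2 + e)
  set b := √(‖y‖ ^ 2 + e)
  have hn : ‖x - y‖ ^ 2 = a ^ 2 + b ^ 2 - 2 * (inner ℝ x y + e) := by
    rw [norm_sub_sq_real, ha2, hb2]; ring
  -- The unit vectors (x, √e)/a and (y, √e)/b have squared distance 2 - 2(⟨x, y⟩ + e)/(ab); the
  -- share of the last coordinate, e(1/a - 1/b)², is subtracted.
  have h : ‖a⁻¹ • x - b⁻¹ • y‖ ^ 2 =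
      (2 * (a * b - (inner ℝ x y + e)) - e * (a - b) ^ 2 / (a * b)) / (a * b) := by
    rw [norm_sub_sq_real, real_inner_smul_left, real_inner_smul_right, norm_smul, norm_smul,
      mul_pow, mul_pow, Real.norm_eq_abs, Real.norm_eq_abs, sq_abs, sq_abs]
    have h1 : ‖x‖ ^ 2 = a ^ 2 - e := by rw [ha2]; ring
    have h2 : ‖y‖ ^ 2 = b ^ 2 - e := by rw [hb2]; ring
    rw [h1, h2]
    field_simp
    ring
  have h4 : e ≤ a * b := by nlinarith
  have h3 : ‖a⁻¹ • x - b⁻¹ • y‖ ^ 2 ≤ ((√e)⁻¹ * ‖x - y‖) ^ 2 := by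
    rw [h, mul_pow, inv_pow, he2, hn, inv_mul_eq_div]
    have h5 : 0 ≤ e * (a - b) ^ 2 / (a * b) := by positivity
    calc (2 * (a * b - (inner ℝ x y + e)) - e * (a - b) ^ 2 / (a * b)) / (a * b)
        ≤ (a ^ 2 + b ^ 2 - 2 * (inner ℝ x y + e)) / (a * b) := by
          refine div_le_div_of_nonneg_right ?_ (by positivity)
          linarith [sq_nonneg (a - b)]
      _ ≤ (a ^ 2 + b ^ 2 - 2 * (inner ℝ x y + e)) / e := by
          gcongr
          rw [← hn]
          positivity
  exact le_of_sq_le_sq h3 (by positivity)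

end Pointwise

variable {d : ℕ}

/-- The viscous stress `κ ↦ (σ / |κ|_n + 2 ν) κ`. -/
noncomputable def stress (σ ν : ℝ) (n : ℕ) (κ : Mat d) : Mat d := viscosity σ ν n κ • κ

theorem stress_zero (σ ν : ℝ) (n : ℕ) : stress σ ν n (0 : Mat d) = 0 := smul_zero _

theorem stress_sub (σ ν : ℝ) (n : ℕ) (κ η : Mat d) :
    stress σ ν n κ - stress σ ν n η =
      σ • ((√(‖κ‖ ^ 2 + ((n : ℝ) ^ 2)⁻¹))⁻¹ • κ - (√(‖η‖ ^ 2 + ((n : ℝ) ^ 2)⁻¹))⁻¹ • η) +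
        (2 * ν) • (κ - η) := by
  simp only [stress, viscosity, add_smul, smul_sub, smul_smul, div_eq_mul_inv]
  abel

theorem stress_mono {σ ν : ℝ} (hσ : 0 ≤ σ) {n : ℕ} (hn : 1 ≤ n) (κ η : Mat d) :
    2 * ν * ‖κ - η‖ ^ 2 ≤ inner ℝ (stress σ ν n κ - stress σ ν n η) (κ - η) := by
  have hn' : (0 : ℝ) < n := by exact_mod_cast hn
  rw [stress_sub, inner_add_left, real_inner_smul_left, real_inner_smul_left,
    real_inner_self_eq_norm_sq]
  have := mul_nonneg hσ (inner_normalize_sub_nonneg (e := ((n : ℝ) ^ 2)⁻¹) (by positivity) κ η)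
  linarith

theorem norm_stress_sub_le {σ ν : ℝ} (hσ : 0 ≤ σ) (hν : 0 < ν) {n : ℕ} (hn : 1 ≤ n)
    (κ η : Mat d) : ‖stress σ ν n κ - stress σ ν n η‖ ≤ (σ * n + 2 * ν) * ‖κ - η‖ := by
  have hn' : (0 : ℝ) < n := by exact_mod_cast hn
  have h := norm_normalize_sub_le (e := ((n : ℝ) ^ 2)⁻¹) (by positivity) κ η
  rw [Real.sqrt_inv, Real.sqrt_sq hn'.le, inv_inv] at h
  rw [stress_sub]
  refine (norm_add_le _ _).trans ?_
  rw [norm_smul, norm_smul, Real.norm_of_nonneg hσ, Real.norm_of_nonneg (by positivity : 0 ≤ 2 * ν),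
    add_mul, mul_assoc σ]
  gcongr

theorem lipschitzWith_stress {σ ν : ℝ} (hσ : 0 ≤ σ) (hν : 0 < ν) {n : ℕ} (hn : 1 ≤ n) :
    LipschitzWith (Real.toNNReal (σ * n + 2 * ν)) (stress (d := d) σ ν n) := by
  refine LipschitzWith.of_dist_le_mul fun κ η => ?_
  rw [dist_eq_norm, dist_eq_norm, Real.coe_toNNReal _ (by positivity)]
  exact norm_stress_sub_le hσ hν hn κ η

/-- The symmetric part as a continuous linear map. -/
noncomputable def symCLM (d : ℕ) : Mat d →L[ℝ] Mat d :=
  LinearMap.toContinuousLinearMap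
    { toFun := sym
      map_add' := fun G H => by
        ext p
        simp [sym]
        ring
      map_smul' := fun c G => by
        ext p
        simp [sym]
        ring }

theorem sum_sq_symm (G : Mat d) : ∑ i : Fin d, ∑ j : Fin d, G (i, j) ^ 2 =
    ∑ i : Fin d, ∑ j : Fin d, (G (i, j) ^ 2 + G (j, i) ^ 2) / 2 := by
  simp only [add_div, Finset.sum_add_distrib]
  rw [Finset.sum_comm (f := fun i j : Fin d => G (j, i) ^ 2 / 2)]
  simp only [← Finset.sum_add_distrib, add_halves]

theorem norm_sym_le (G : Mat d) : ‖sym G‖ ≤ ‖G‖ := by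
  have h : ‖sym G‖ ^ 2 ≤ ‖G‖ ^ 2 := by
    rw [EuclideanSpace.real_norm_sq_eq, EuclideanSpace.real_norm_sq_eq, Fintype.sum_prod_type,
      Fintype.sum_prod_type]
    rw [sum_sq_symm G]
    refine Finset.sum_le_sum fun i _ => Finset.sum_le_sum fun j _ => ?_
    simp only [sym]
    nlinarith [sq_nonneg (G (i, j) - G (j, i))]
  exact le_of_sq_le_sq h (norm_nonneg _)

/-! ### The norms, the symmetric gradient and the stress on L² -/

section Lp

variable {Ω : Set (Vec d)}

/-- The symmetric part on `L²(Ω)^{d × d}`. -/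
noncomputable def symLp (Ω : Set (Vec d)) :
    Lp (Mat d) 2 (volume.restrict Ω) →L[ℝ] Lp (Mat d) 2 (volume.restrict Ω) :=
  (symCLM d).compLpL 2 (volume.restrict Ω)

theorem coeFn_symLp (U : FieldPair Ω) : symLp Ω U.2 =ᵐ[volume.restrict Ω] symGrad U := by
  filter_upwards [(symCLM d).coeFn_compLp U.2] with x hx
  exact hx

theorem norm_sq_eq_integral {E : Type*} [NormedAddCommGroup E] [InnerProductSpace ℝ E]
    (G : Lp E 2 (volume.restrict Ω)) : ‖G‖ ^ 2 = ∫ x in Ω, ‖G x‖ ^ 2 := by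
  rw [← real_inner_self_eq_norm_sq, L2.inner_def]
  simp only [real_inner_self_eq_norm_sq]

theorem gradNorm_eq (U : FieldPair Ω) : gradNorm U = ‖U.2‖ := by
  rw [gradNorm, ← norm_sq_eq_integral, Real.sqrt_sq (norm_nonneg _)]

theorem symInner_eq (U V : FieldPair Ω) : symInner U V = inner ℝ (symLp Ω U.2) (symLp Ω V.2) := by
  rw [symInner, L2.inner_def]
  refine integral_congr_ae ?_
  filter_upwards [coeFn_symLp U, coeFn_symLp V] with x h1 h2
  rw [h1, h2]

theorem symNorm_eq (U : FieldPair Ω) : symNorm U = ‖symLp Ω U.2‖ := by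
  rw [symNorm, ← Real.sqrt_sq (norm_nonneg (symLp Ω U.2)), norm_sq_eq_integral]
  congr 1
  refine integral_congr_ae ?_
  filter_upwards [coeFn_symLp U] with x h1
  simp only [h1]

theorem norm_symLp_le (G : Lp (Mat d) 2 (volume.restrict Ω)) : ‖symLp Ω G‖ ≤ ‖G‖ := by
  refine Lp.norm_le_norm_of_ae_le ?_
  filter_upwards [(symCLM d).coeFn_compLp G] with x hx
  change ‖(symCLM d).compLp G x‖ ≤ _
  rw [hx]
  exact norm_sym_le _

/-- The viscous stress on `L²(Ω)^{d × d}`. -/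
noncomputable def stressLp {σ ν : ℝ} (hσ : 0 ≤ σ) (hν : 0 < ν) {n : ℕ} (hn : 1 ≤ n) :
    Lp (Mat d) 2 (volume.restrict Ω) → Lp (Mat d) 2 (volume.restrict Ω) :=
  (lipschitzWith_stress hσ hν hn).compLp (stress_zero σ ν n)

variable {σ ν : ℝ} (hσ : 0 ≤ σ) (hν : 0 < ν) {n : ℕ} (hn : 1 ≤ n)

theorem viscousForm_eq (U W : FieldPair Ω) :
    viscousForm σ ν n U U W = inner ℝ (stressLp hσ hν hn (symLp Ω U.2)) (symLp Ω W.2) := by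
  rw [viscousForm, L2.inner_def]
  refine integral_congr_ae ?_
  filter_upwards [coeFn_symLp U, coeFn_symLp W,
    (lipschitzWith_stress hσ hν hn).coeFn_compLp (stress_zero σ ν n) (symLp Ω U.2)] with x h1 h2 h3
  rw [h2, stressLp, h3, Function.comp_apply, h1, stress, real_inner_smul_left]

theorem stressLp_zero : stressLp hσ hν hn (0 : Lp (Mat d) 2 (volume.restrict Ω)) = 0 := by
  rw [Lp.eq_zero_iff_ae_eq_zero]
  filter_upwards [Lp.coeFn_zero (Mat d) 2 (volume.restrict Ω),
    (lipschitzWith_stress hσ hν hn).coeFn_compLp (stress_zero σ ν n)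
      (0 : Lp (Mat d) 2 (volume.restrict Ω))] with x h1 h2
  rw [stressLp, h2, Function.comp_apply, h1]
  exact stress_zero σ ν n

theorem norm_stressLp_sub_le (G K : Lp (Mat d) 2 (volume.restrict Ω)) :
    ‖stressLp hσ hν hn G - stressLp hσ hν hn K‖ ≤ (σ * n + 2 * ν) * ‖G - K‖ := by
  have := (lipschitzWith_stress hσ hν hn).norm_compLp_sub_le (stress_zero σ ν n) G K
  rwa [Real.coe_toNNReal _ (by positivity)] at this

theorem stressLp_mono (G K : Lp (Mat d) 2 (volume.restrict Ω)) :
    2 * ν * ‖G - K‖ ^ 2 ≤ inner ℝ (stressLp hσ hν hn G - stressLp hσ hν hn K) (G - K) := by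
  rw [← real_inner_self_eq_norm_sq, ← real_inner_smul_left, L2.inner_def, L2.inner_def]
  refine integral_mono_ae (L2.integrable_inner _ _) (L2.integrable_inner _ _) ?_
  filter_upwards [Lp.coeFn_sub G K, Lp.coeFn_sub (stressLp hσ hν hn G) (stressLp hσ hν hn K),
    Lp.coeFn_smul (2 * ν) (G - K),
    (lipschitzWith_stress hσ hν hn).coeFn_compLp (stress_zero σ ν n) G,
    (lipschitzWith_stress hσ hν hn).coeFn_compLp (stress_zero σ ν n) K] with x h1 h2 h3 h4 h5
  rw [h3, Pi.smul_apply, h2, h1, Pi.sub_apply, Pi.sub_apply, real_inner_smul_left,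
    real_inner_self_eq_norm_sq]
  have := stress_mono (ν := ν) hσ hn (G x) (K x)
  rw [stressLp, h4, h5]
  exact this

end Lp

end Bingham

namespace Bingham

variable {d : ℕ}

/-! ### Korn's inequality -/

section Korn

theorem contDiff_fderiv_apply {E : Type*} [NormedAddCommGroup E] [NormedSpace ℝ E]
    {f : E → ℝ} (hf : ContDiff ℝ (⊤ : ℕ∞) f) (v : E) :
    ContDiff ℝ (⊤ : ℕ∞) fun x => fderiv ℝ f x v :=
  (hf.fderiv_right (m := (⊤ : ℕ∞)) (by simp)).clm_apply contDiff_const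

theorem hasCompactSupport_fderiv_apply {E : Type*} [NormedAddCommGroup E] [NormedSpace ℝ E]
    {f : E → ℝ} (hf : HasCompactSupport f) (v : E) :
    HasCompactSupport fun x => fderiv ℝ f x v :=
  (hf.fderiv ℝ).comp_left (g := fun L : E →L[ℝ] ℝ => L v) (by simp)

/-- Integrating by parts moves the derivative from g onto f, whose second derivative is symmetric.
Compact support of f alone removes the boundary terms. -/
theorem integral_fderiv_mul_fderiv_comm {f g : Vec d → ℝ} (hf : ContDiff ℝ (⊤ : ℕ∞) f)
    (hfc : HasCompactSupport f) (hg : ContDiff ℝ (⊤ : ℕ∞) g) (v w : Vec d) :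
    ∫ x, fderiv ℝ f x v * fderiv ℝ g x w = ∫ x, fderiv ℝ f x w * fderiv ℝ g x v := by
  have key : ∀ v w : Vec d, ∫ x, fderiv ℝ f x v * fderiv ℝ g x w =
      - ∫ x, fderiv ℝ (fderiv ℝ f) x w v * g x := by
    intro v w
    have hv := contDiff_fderiv_apply hf v
    have hvc := hasCompactSupport_fderiv_apply hfc v
    have hd : ∀ x, fderiv ℝ (fun y => fderiv ℝ f y v) x w = fderiv ℝ (fderiv ℝ f) x w v := by
      intro x
      have h1 : DifferentiableAt ℝ (fderiv ℝ f) x :=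
        (hf.fderiv_right (m := (⊤ : ℕ∞)) (by simp)).differentiable (by simp) x
      rw [fderiv_clm_apply h1 (differentiableAt_const v)]
      simp
    simp only [← hd]
    refine integral_mul_fderiv_eq_neg_fderiv_mul_of_integrable ?_ ?_ ?_
      (fun x _ => hv.differentiable (by simp) x) (fun x _ => hg.differentiable (by simp) x)
    · exact ((contDiff_fderiv_apply hv w).continuous.mul hg.continuous).integrable_of_hasCompactSupport
        ((hasCompactSupport_fderiv_apply hvc w).mul_right)
    · exact (hv.continuous.mul (contDiff_fderiv_apply hg w).continuous).integrable_of_hasCompactSupport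
        hvc.mul_right
    · exact (hv.continuous.mul hg.continuous).integrable_of_hasCompactSupport hvc.mul_right
  rw [key v w, key w v]
  congr 2
  ext x
  have hs : IsSymmSndFDerivAt ℝ f x :=
    hf.contDiffAt.isSymmSndFDerivAt (by
      rw [minSmoothness_of_isRCLikeNormedField]
      exact WithTop.coe_le_coe.2 (le_top : (2 : ℕ∞) ≤ ⊤))
  rw [hs.eq w v]

variable {φ : Vec d → Vec d}

theorem grad_apply (hφ : ContDiff ℝ (⊤ : ℕ∞) φ) (x : Vec d) (i j : Fin d) :
    grad φ x (i, j) = fderiv ℝ (fun y => φ y j) x (EuclideanSpace.single i 1) := by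
  have h := (EuclideanSpace.proj (𝕜 := ℝ) j : Vec d →L[ℝ] ℝ).hasFDerivAt.comp x
    (hφ.differentiable (by simp) x).hasFDerivAt
  have e : fderiv ℝ (fun y => φ y j) x =
    (EuclideanSpace.proj (𝕜 := ℝ) j : Vec d →L[ℝ] ℝ).comp (fderiv ℝ φ x) := h.fderiv
  rw [e]
  rfl

theorem contDiff_component (hφ : ContDiff ℝ (⊤ : ℕ∞) φ) (j : Fin d) :
    ContDiff ℝ (⊤ : ℕ∞) fun y => φ y j :=
  (EuclideanSpace.proj (𝕜 := ℝ) j : Vec d →L[ℝ] ℝ).contDiff.comp hφ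

theorem hasCompactSupport_component (hφ : HasCompactSupport φ) (j : Fin d) :
    HasCompactSupport fun y => φ y j :=
  hφ.comp_left (g := fun y : Vec d => y j) rfl

theorem continuous_grad_apply (hφ : ContDiff ℝ (⊤ : ℕ∞) φ) (i j : Fin d) :
    Continuous fun x => grad φ x (i, j) := by
  simp only [grad_apply hφ]
  exact (contDiff_fderiv_apply (contDiff_component hφ j) _).continuous

theorem continuous_grad (hφ : ContDiff ℝ (⊤ : ℕ∞) φ) : Continuous (grad φ) := by
  refine (PiLp.continuous_toLp 2 (fun _ : Fin d × Fin d => ℝ)).comp (continuous_pi fun p => ?_)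
  exact continuous_grad_apply hφ p.1 p.2

theorem tsupport_grad_subset (φ : Vec d → Vec d) : tsupport (grad φ) ⊆ tsupport φ := by
  refine (closure_mono fun x hx => ?_).trans (tsupport_fderiv_subset ℝ (f := φ))
  rw [Function.mem_support] at hx ⊢
  intro h
  apply hx
  ext p
  simp [grad, h]

/-- Exchanging the two derivatives under the integral turns ∇φ : (∇φ)ᵀ into the square of the
divergence. -/
theorem integral_grad_mul_transpose_nonneg (hφ : ContDiff ℝ (⊤ : ℕ∞) φ)
    (hφc : HasCompactSupport φ) :
    0 ≤ ∫ x, ∑ i, ∑ j, grad φ x (i, j) * grad φ x (j, i) := by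
  have hint : ∀ i j k l : Fin d, Integrable fun x => grad φ x (i, j) * grad φ x (k, l) := by
    intro i j k l
    refine ((continuous_grad_apply hφ i j).mul
      (continuous_grad_apply hφ k l)).integrable_of_hasCompactSupport ?_
    refine HasCompactSupport.mul_right ?_
    simp only [grad_apply hφ]
    exact hasCompactSupport_fderiv_apply (hasCompactSupport_component hφc j) _
  have h : ∫ x, ∑ i, ∑ j, grad φ x (i, j) * grad φ x (j, i) =
      ∫ x, ∑ i, ∑ j, grad φ x (i, i) * grad φ x (j, j) := by
    rw [integral_finsetSum _ fun i _ => integrable_finsetSum _ fun j _ => hint i j j i,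
      integral_finsetSum _ fun i _ => integrable_finsetSum _ fun j _ => hint i i j j]
    refine Finset.sum_congr rfl fun i _ => ?_
    rw [integral_finsetSum _ fun j _ => hint i j j i,
      integral_finsetSum _ fun j _ => hint i i j j]
    refine Finset.sum_congr rfl fun j _ => ?_
    have := integral_fderiv_mul_fderiv_comm (contDiff_component hφ j)
      (hasCompactSupport_component hφc j) (contDiff_component hφ i)
      (EuclideanSpace.single i 1) (EuclideanSpace.single j 1)
    simp only [grad_apply hφ]
    rw [this]
    simp only [mul_comm]
  rw [h]
  refine integral_nonneg fun x => ?_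
  simp only [Pi.zero_apply]
  rw [← Fintype.sum_mul_sum]
  exact mul_self_nonneg _

theorem two_mul_norm_sym_sq (G : Mat d) :
    2 * ‖sym G‖ ^ 2 = ‖G‖ ^ 2 + ∑ i, ∑ j, G (i, j) * G (j, i) := by
  rw [EuclideanSpace.real_norm_sq_eq, EuclideanSpace.real_norm_sq_eq, Fintype.sum_prod_type,
    Fintype.sum_prod_type]
  rw [sum_sq_symm G, ← Finset.sum_add_distrib, Finset.mul_sum]
  refine Finset.sum_congr rfl fun i _ => ?_
  rw [← Finset.sum_add_distrib, Finset.mul_sum]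
  refine Finset.sum_congr rfl fun j _ => ?_
  simp only [sym]
  ring

/-- Korn's inequality on `W_0^{1,2}`. -/
theorem korn {Ω : Set (Vec d)} {U : FieldPair Ω} (hU : U ∈ sobolevZero Ω) :
    ‖U.2‖ ^ 2 ≤ 2 * ‖symLp Ω U.2‖ ^ 2 := by
  have hclosed : IsClosed {U : FieldPair Ω | ‖U.2‖ ^ 2 ≤ 2 * ‖symLp Ω U.2‖ ^ 2} :=
    isClosed_le (by fun_prop) (by fun_prop)
  -- Both sides are continuous in the L² gradient, so test fields suffice.
  refine closure_minimal (s := (testPairs Ω : Set (FieldPair Ω))) ?_ hclosed hU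
  rintro U ⟨φ, hφ, hφc, hφs, -, hU2⟩
  rw [Set.mem_ofPred_eq, norm_sq_eq_integral, norm_sq_eq_integral, ← integral_const_mul]
  have h1 : ∫ x in Ω, 2 * ‖symLp Ω U.2 x‖ ^ 2 =
      ∫ x in Ω, (‖U.2 x‖ ^ 2 + ∑ i, ∑ j, grad φ x (i, j) * grad φ x (j, i)) := by
    refine integral_congr_ae ?_
    filter_upwards [coeFn_symLp U, hU2] with x h1 h2
    rw [h1, symGrad, two_mul_norm_sym_sq, h2]
  have hc : Continuous fun x => ∑ i, ∑ j, grad φ x (i, j) * grad φ x (j, i) :=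
    continuous_finsetSum _ fun i _ => continuous_finsetSum _ fun j _ =>
      (continuous_grad_apply hφ i j).mul (continuous_grad_apply hφ j i)
  have hz : ∀ x, x ∉ tsupport φ → grad φ x = 0 := fun x hx =>
    image_eq_zero_of_notMem_tsupport fun h => hx (tsupport_grad_subset φ h)
  have hs : HasCompactSupport fun x => ∑ i, ∑ j, grad φ x (i, j) * grad φ x (j, i) :=
    HasCompactSupport.intro hφc fun x hx => by simp [hz x hx]
  have h2 : ∫ x in Ω, ∑ i, ∑ j, grad φ x (i, j) * grad φ x (j, i) =
      ∫ x, ∑ i, ∑ j, grad φ x (i, j) * grad φ x (j, i) :=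
    setIntegral_eq_integral_of_forall_compl_eq_zero fun x hx => by
      simp [hz x fun h => hx (hφs h)]
  have hi := (hc.integrable_of_hasCompactSupport (μ := volume) hs).integrableOn (s := Ω)
  have hi2 : Integrable (fun x => ‖U.2 x‖ ^ 2) (volume.restrict Ω) :=
    (Lp.memLp U.2).integrable_norm_pow (by simp)
  rw [h1, integral_add hi2 hi, h2]
  linarith [integral_grad_mul_transpose_nonneg hφ hφc]

end Korn

/-! ### The Sobolev embedding into L⁴ and Poincaré's inequality -/

section Sobolev

theorem norm_fderiv_le_norm_grad (φ : Vec d → Vec d) (x : Vec d) :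
    ‖fderiv ℝ φ x‖ ≤ ‖grad φ x‖ := by
  refine ContinuousLinearMap.opNorm_le_bound _ (norm_nonneg _) fun v => ?_
  have hv : fderiv ℝ φ x v = WithLp.toLp 2 fun j => ∑ i, grad φ x (i, j) * v i := by
    have h1 : v = ∑ i, v i • EuclideanSpace.single i (1 : ℝ) := by
      ext j
      simp [Finset.sum_apply, Pi.single_apply]
    conv_lhs => rw [h1]
    ext j
    simp [map_sum, grad, mul_comm]
  have h : ‖fderiv ℝ φ x v‖ ^ 2 ≤ (‖grad φ x‖ * ‖v‖) ^ 2 := by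
    rw [hv, mul_pow, EuclideanSpace.real_norm_sq_eq, EuclideanSpace.real_norm_sq_eq,
      EuclideanSpace.real_norm_sq_eq, Fintype.sum_prod_type, Finset.sum_comm, Finset.sum_mul]
    exact Finset.sum_le_sum fun j _ => by
      exact Finset.sum_mul_sq_le_sq_mul_sq Finset.univ (fun i => grad φ x (i, j)) fun i => v i
  exact le_of_sq_le_sq h (by positivity)

variable {Ω : Set (Vec d)}

/-- The Sobolev inequality `‖u‖_4 ≤ C ‖∇u‖_2` for test fields. -/
theorem exists_sobolev_test (hd : d = 2 ∨ d = 3) (hΩb : Bornology.IsBounded Ω) :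
    ∃ C : NNReal, ∀ U ∈ testPairs Ω,
      eLpNorm U.1 4 (volume.restrict Ω) ≤ C * eLpNorm U.2 2 (volume.restrict Ω) := by
  have hfin : volume Ω < ⊤ := hΩb.measure_lt_top
  obtain ⟨p, hp1, hp2, hp⟩ : ∃ p : NNReal, 1 ≤ p ∧ p ≤ 2 ∧
      (((4 : NNReal) : ℝ))⁻¹ = (p : ℝ)⁻¹ - (Module.finrank ℝ (Vec d) : ℝ)⁻¹ := by
    -- The exponent solves 1/4 = 1/p - 1/d. Both values are below 2, so Hölder on the finite-measure
    -- set Ω passes from L^p to L² gradients.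
    rcases hd with rfl | rfl
    · refine ⟨4 / 3, ?_, ?_, ?_⟩
      · rw [one_le_div] <;> norm_num
      · rw [div_le_iff₀] <;> norm_num
      · norm_num
    · refine ⟨12 / 7, ?_, ?_, ?_⟩
      · rw [one_le_div] <;> norm_num
      · rw [div_le_iff₀] <;> norm_num
      · norm_num
  have hn : 0 < Module.finrank ℝ (Vec d) := by
    rw [finrank_euclideanSpace_fin]; omega
  set m : ENNReal := (volume.restrict Ω) Set.univ ^ (1 / (p : ENNReal).toReal - 1 / (2 : ENNReal).toReal)
  have hm : m ≠ ⊤ := by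
    refine ENNReal.rpow_ne_top_of_nonneg ?_ (by simpa using hfin.ne)
    have : (0 : ℝ) < p := lt_of_lt_of_le one_pos (by exact_mod_cast hp1)
    have h2 : (p : ℝ) ≤ 2 := by exact_mod_cast hp2
    simp only [ENNReal.coe_toReal, ENNReal.toReal_ofNat, sub_nonneg]
    exact one_div_le_one_div_of_le this h2
  refine ⟨SNormLESNormFDerivOfEqConst (Vec d) (volume : Measure (Vec d)) p * m.toNNReal, ?_⟩
  rintro U ⟨φ, hφ, hφc, hφs, hU1, hU2⟩
  rw [eLpNorm_congr_ae hU1, eLpNorm_congr_ae hU2]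
  have h1 := eLpNorm_le_eLpNorm_fderiv_of_eq (volume : Measure (Vec d))
    (hφ.of_le (by simp)) hφc hp1 hn hp
  have h2 : eLpNorm (fderiv ℝ φ) p volume ≤ eLpNorm (grad φ) p (volume.restrict Ω) := by
    refine (eLpNorm_mono (norm_fderiv_le_norm_grad φ)).trans (le_of_eq ?_)
    refine (eLpNorm_restrict_eq_of_support_subset ?_).symm
    exact (subset_tsupport _).trans ((tsupport_grad_subset φ).trans hφs)
  have h3 : eLpNorm (grad φ) p (volume.restrict Ω) ≤ eLpNorm (grad φ) 2 (volume.restrict Ω) * m :=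
    eLpNorm_le_eLpNorm_mul_rpow_measure_univ (by exact_mod_cast hp2)
      (continuous_grad hφ).aestronglyMeasurable
  calc eLpNorm φ 4 (volume.restrict Ω) ≤ eLpNorm φ 4 volume :=
        eLpNorm_mono_measure _ Measure.restrict_le_self
    _ ≤ _ := h1
    _ ≤ _ := mul_le_mul_right (h2.trans h3) _
    _ = _ := by
      rw [ENNReal.coe_mul, ENNReal.coe_toNNReal hm]
      ring

/-- The Sobolev inequality `‖u‖_4 ≤ C ‖∇u‖_2` on `W_0^{1,2}`. -/
theorem exists_sobolev (hd : d = 2 ∨ d = 3) (hΩb : Bornology.IsBounded Ω) :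
    ∃ C : NNReal, ∀ U ∈ sobolevZero Ω,
      eLpNorm U.1 4 (volume.restrict Ω) ≤ C * eLpNorm U.2 2 (volume.restrict Ω) := by
  obtain ⟨C, hC⟩ := exists_sobolev_test hd hΩb
  refine ⟨C, fun U hU => ?_⟩
  obtain ⟨u, hu, hlim⟩ := mem_closure_iff_seq_limit.1 hU
  have h1 : Tendsto (fun k => (u k).1) atTop (𝓝 U.1) := (continuous_fst.tendsto U).comp hlim
  have h2 : Tendsto (fun k => (u k).2) atTop (𝓝 U.2) := (continuous_snd.tendsto U).comp hlim
  -- L² convergence does not control the L⁴ norm; an almost everywhere convergent subsequence and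
  -- Fatou's lemma give the lower semicontinuity needed.
  obtain ⟨ns, hns, hae⟩ := (tendstoInMeasure_of_tendsto_Lp h1).exists_seq_tendsto_ae
  have h3 : Tendsto (fun k => (C : ENNReal) * eLpNorm (u (ns k)).2 2 (volume.restrict Ω)) atTop
      (𝓝 (C * eLpNorm U.2 2 (volume.restrict Ω))) := by
    refine ENNReal.Tendsto.const_mul ?_ (Or.inr ENNReal.coe_ne_top)
    have h4 := (ENNReal.continuous_ofReal.tendsto _).comp
      ((h2.comp hns.tendsto_atTop).norm)
    simpa only [Lp.norm_def, Function.comp_def, ENNReal.ofReal_toReal (Lp.eLpNorm_ne_top _)]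
      using h4
  calc eLpNorm U.1 4 (volume.restrict Ω)
      ≤ atTop.liminf fun k => eLpNorm (u (ns k)).1 4 (volume.restrict Ω) :=
        Lp.eLpNorm_lim_le_liminf_eLpNorm (fun k => Lp.aestronglyMeasurable _) _ hae
    _ ≤ atTop.liminf fun k => (C : ENNReal) * eLpNorm (u (ns k)).2 2 (volume.restrict Ω) :=
        liminf_le_liminf (Eventually.of_forall fun k => hC _ (hu _))
    _ = _ := h3.liminf_eq

end Sobolev

end Bingham

namespace Bingham

variable {d : ℕ} {Ω : Set (Vec d)}

/-- Poincaré's inequality on `W_0^{1,2}`. -/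
theorem exists_poincare (hd : d = 2 ∨ d = 3) (hΩb : Bornology.IsBounded Ω) :
    ∃ C : ℝ, 0 ≤ C ∧ ∀ U ∈ sobolevZero Ω, ‖U.1‖ ≤ C * ‖U.2‖ := by
  obtain ⟨C, hC⟩ := exists_sobolev hd hΩb
  have hfin : volume Ω < ⊤ := hΩb.measure_lt_top
  set m : ENNReal := (volume.restrict Ω) Set.univ ^
    (1 / (2 : ENNReal).toReal - 1 / (4 : ENNReal).toReal)
  have hm : m ≠ ⊤ := by
    refine ENNReal.rpow_ne_top_of_nonneg ?_ (by simpa using hfin.ne)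
    simp only [ENNReal.toReal_ofNat]
    norm_num
  refine ⟨C * m.toReal, by positivity, fun U hU => ?_⟩
  have h1 : eLpNorm U.1 2 (volume.restrict Ω) ≤ eLpNorm U.1 4 (volume.restrict Ω) * m :=
    eLpNorm_le_eLpNorm_mul_rpow_measure_univ (by norm_num) (Lp.aestronglyMeasurable _)
  have h2 : eLpNorm U.1 2 (volume.restrict Ω) ≤
      C * eLpNorm U.2 2 (volume.restrict Ω) * m := h1.trans (mul_le_mul_left (hC U hU) _)
  have h3 := ENNReal.toReal_mono
    (ENNReal.mul_ne_top (ENNReal.mul_ne_top ENNReal.coe_ne_top (Lp.eLpNorm_ne_top U.2)) hm) h2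
  rw [Lp.norm_def, Lp.norm_def]
  simp only [ENNReal.toReal_mul, ENNReal.coe_toReal] at h3
  linarith

/-! ### The trilinear form: integrability, bound and linearity -/

section Trilinear

/-- The pointwise trilinear form `(v ⊗ h) : G`. -/
def tensorContract (v h : Vec d) (G : Mat d) : ℝ := ∑ i, ∑ j, v i * h j * G (i, j)

theorem abs_tensorContract_le (v h : Vec d) (G : Mat d) :
    |tensorContract v h G| ≤ ‖v‖ * ‖h‖ * ‖G‖ := by
  refine abs_le_of_sq_le_sq ?_ (by positivity)
  have h1 : tensorContract v h G = ∑ p : Fin d × Fin d, (v p.1 * h p.2) * G p := by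
    rw [Fintype.sum_prod_type]
    rfl
  have h2 : ‖v‖ ^ 2 * ‖h‖ ^ 2 = ∑ p : Fin d × Fin d, (v p.1 * h p.2) ^ 2 := by
    rw [EuclideanSpace.real_norm_sq_eq, EuclideanSpace.real_norm_sq_eq, Fintype.sum_mul_sum,
      Fintype.sum_prod_type]
    simp only [mul_pow]
  rw [h1, mul_pow, mul_pow, h2, EuclideanSpace.real_norm_sq_eq]
  exact Finset.sum_mul_sq_le_sq_mul_sq _ _ _

theorem continuous_tensorContract :
    Continuous fun p : Vec d × Vec d × Mat d => tensorContract p.1 p.2.1 p.2.2 := by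
  unfold tensorContract
  fun_prop

/-- The trilinear form `∫_Ω (v ⊗ h) : ∇w`. -/
noncomputable def tensorForm (v h w : FieldPair Ω) : ℝ :=
  ∫ x in Ω, tensorContract (v.1 x) (h.1 x) (w.2 x)

theorem holderTriple_four : ENNReal.HolderTriple 4 4 2 := by
  refine ⟨?_⟩
  rw [← ENNReal.toReal_eq_toReal_iff' (by simp) (by simp),
    ENNReal.toReal_add (by simp) (by simp)]
  simp only [ENNReal.toReal_inv, ENNReal.toReal_ofNat]
  norm_num

/-- Hölder with 1/4 + 1/4 + 1/2 = 1, applied in two stages. -/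
theorem eLpNorm_tensorContract_le (v h w : FieldPair Ω) :
    eLpNorm (fun x => tensorContract (v.1 x) (h.1 x) (w.2 x)) 1 (volume.restrict Ω) ≤
      eLpNorm v.1 4 (volume.restrict Ω) * eLpNorm h.1 4 (volume.restrict Ω) *
        eLpNorm w.2 2 (volume.restrict Ω) := by
  have hv := (Lp.aestronglyMeasurable v.1).norm
  have hh := (Lp.aestronglyMeasurable h.1).norm
  have hw := (Lp.aestronglyMeasurable w.2).norm
  have := holderTriple_four
  have h1 := eLpNorm_smul_le_mul_eLpNorm (p := 4) (q := 4) (r := 2) hh hv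
  have h2 := eLpNorm_smul_le_mul_eLpNorm (p := 2) (q := 2) (r := 1) hw (hv.smul hh)
  simp only [eLpNorm_norm] at h1 h2
  refine (eLpNorm_mono fun x => ?_).trans (h2.trans (mul_le_mul_left h1 _))
  rw [Real.norm_eq_abs]
  refine (abs_tensorContract_le _ _ _).trans (le_of_eq ?_)
  simp

theorem aestronglyMeasurable_tensorContract (v h w : FieldPair Ω) :
    AEStronglyMeasurable (fun x => tensorContract (v.1 x) (h.1 x) (w.2 x))
      (volume.restrict Ω) :=
  Continuous.comp_aestronglyMeasurable
    (g := fun p : Vec d × Vec d × Mat d => tensorContract p.1 p.2.1 p.2.2)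
    (f := fun x => (v.1 x, h.1 x, w.2 x)) continuous_tensorContract
    ((Lp.aestronglyMeasurable v.1).prodMk
      ((Lp.aestronglyMeasurable h.1).prodMk (Lp.aestronglyMeasurable w.2)))

variable {C : NNReal} (hC : ∀ U ∈ sobolevZero Ω,
  eLpNorm U.1 4 (volume.restrict Ω) ≤ C * eLpNorm U.2 2 (volume.restrict Ω))
include hC

theorem eLpNorm_tensorContract_le_of_sobolev {v h : FieldPair Ω} (hv : v ∈ sobolevZero Ω)
    (hh : h ∈ sobolevZero Ω) (w : FieldPair Ω) :
    eLpNorm (fun x => tensorContract (v.1 x) (h.1 x) (w.2 x)) 1 (volume.restrict Ω) ≤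
      ENNReal.ofReal (C ^ 2 * ‖v.2‖ * ‖h.2‖ * ‖w.2‖) := by
  refine (eLpNorm_tensorContract_le v h w).trans ?_
  refine (mul_le_mul_left (mul_le_mul' (hC v hv) (hC h hh)) _).trans (le_of_eq ?_)
  rw [ENNReal.ofReal_mul (by positivity), ENNReal.ofReal_mul (by positivity),
    ENNReal.ofReal_mul (by positivity), ENNReal.ofReal_pow (by positivity),
    ENNReal.ofReal_coe_nnreal]
  simp only [Lp.norm_def, ENNReal.ofReal_toReal (Lp.eLpNorm_ne_top _)]
  ring

theorem integrable_tensorContract {v h : FieldPair Ω} (hv : v ∈ sobolevZero Ω)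
    (hh : h ∈ sobolevZero Ω) (w : FieldPair Ω) :
    Integrable (fun x => tensorContract (v.1 x) (h.1 x) (w.2 x)) (volume.restrict Ω) := by
  rw [← memLp_one_iff_integrable]
  exact ⟨aestronglyMeasurable_tensorContract v h w,
    (eLpNorm_tensorContract_le_of_sobolev hC hv hh w).trans_lt ENNReal.ofReal_lt_top⟩

theorem abs_tensorForm_le {v h : FieldPair Ω} (hv : v ∈ sobolevZero Ω)
    (hh : h ∈ sobolevZero Ω) (w : FieldPair Ω) :
    |tensorForm v h w| ≤ C ^ 2 * ‖v.2‖ * ‖h.2‖ * ‖w.2‖ := by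
  rw [tensorForm, ← Real.norm_eq_abs]
  refine (norm_integral_le_integral_norm _).trans ?_
  rw [integral_norm_eq_lintegral_enorm (aestronglyMeasurable_tensorContract v h w),
    ← eLpNorm_one_eq_lintegral_enorm]
  exact ENNReal.toReal_le_of_le_ofReal (by positivity)
    (eLpNorm_tensorContract_le_of_sobolev hC hv hh w)

/-- Splitting the integral requires each half to be integrable, which the L⁴ bound supplies. -/
theorem convection_eq {v w h : FieldPair Ω} (hv : v ∈ sobolevZero Ω)
    (hw : w ∈ sobolevZero Ω) (hh : h ∈ sobolevZero Ω) :
    convection v w h = 1 / 2 * (tensorForm v h w - tensorForm v w h) := by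
  rw [tensorForm, tensorForm, ← integral_sub (integrable_tensorContract hC hv hh w)
    (integrable_tensorContract hC hv hw h)]
  rfl

/-- The shape u + c • v carries additivity and homogeneity at once; c = -1 later gives differences.
-/
theorem tensorForm_add_smul_left {u v h : FieldPair Ω} (hu : u ∈ sobolevZero Ω)
    (hv : v ∈ sobolevZero Ω) (hh : h ∈ sobolevZero Ω) (w : FieldPair Ω) (c : ℝ) :
    tensorForm (u + c • v) h w = tensorForm u h w + c * tensorForm v h w := by
  rw [tensorForm, tensorForm, tensorForm, ← integral_const_mul,
    ← integral_add (integrable_tensorContract hC hu hh w)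
      ((integrable_tensorContract hC hv hh w).const_mul c)]
  refine integral_congr_ae ?_
  filter_upwards [Lp.coeFn_add u.1 (c • v.1), Lp.coeFn_smul c v.1] with x h1 h2
  rw [Prod.fst_add, Prod.smul_fst, h1, Pi.add_apply, h2]
  simp only [tensorContract, Finset.mul_sum, ← Finset.sum_add_distrib]
  refine Finset.sum_congr rfl fun i _ => Finset.sum_congr rfl fun j _ => ?_
  simp only [PiLp.add_apply, Pi.smul_apply, PiLp.smul_apply, smul_eq_mul]
  ring

theorem tensorForm_add_smul_mid {u h k : FieldPair Ω} (hu : u ∈ sobolevZero Ω)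
    (hh : h ∈ sobolevZero Ω) (hk : k ∈ sobolevZero Ω) (w : FieldPair Ω) (c : ℝ) :
    tensorForm u (h + c • k) w = tensorForm u h w + c * tensorForm u k w := by
  rw [tensorForm, tensorForm, tensorForm, ← integral_const_mul,
    ← integral_add (integrable_tensorContract hC hu hh w)
      ((integrable_tensorContract hC hu hk w).const_mul c)]
  refine integral_congr_ae ?_
  filter_upwards [Lp.coeFn_add h.1 (c • k.1), Lp.coeFn_smul c k.1] with x h1 h2
  rw [Prod.fst_add, Prod.smul_fst, h1, Pi.add_apply, h2]
  simp only [tensorContract, Finset.mul_sum, ← Finset.sum_add_distrib]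
  refine Finset.sum_congr rfl fun i _ => Finset.sum_congr rfl fun j _ => ?_
  simp only [PiLp.add_apply, Pi.smul_apply, PiLp.smul_apply, smul_eq_mul]
  ring

theorem tensorForm_add_smul_right {u h : FieldPair Ω} (hu : u ∈ sobolevZero Ω)
    (hh : h ∈ sobolevZero Ω) (v w : FieldPair Ω) (c : ℝ) :
    tensorForm u h (v + c • w) = tensorForm u h v + c * tensorForm u h w := by
  rw [tensorForm, tensorForm, tensorForm, ← integral_const_mul,
    ← integral_add (integrable_tensorContract hC hu hh v)
      ((integrable_tensorContract hC hu hh w).const_mul c)]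
  refine integral_congr_ae ?_
  filter_upwards [Lp.coeFn_add v.2 (c • w.2), Lp.coeFn_smul c w.2] with x h1 h2
  rw [Prod.snd_add, Prod.smul_snd, h1, Pi.add_apply, h2]
  simp only [tensorContract, Finset.mul_sum, ← Finset.sum_add_distrib]
  refine Finset.sum_congr rfl fun i _ => Finset.sum_congr rfl fun j _ => ?_
  simp only [PiLp.add_apply, Pi.smul_apply, PiLp.smul_apply, smul_eq_mul]
  ring

omit hC

theorem exists_isConvectionBound (hd : d = 2 ∨ d = 3) (hΩb : Bornology.IsBounded Ω) :
    ∃ C : ℝ, 0 < C ∧ IsConvectionBound Ω C := by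
  obtain ⟨C, hC⟩ := exists_sobolev hd hΩb
  -- The summand 1 only ensures a strictly positive constant, as C may be 0.
  refine ⟨C ^ 2 + 1, by positivity, fun v hv w hw h hh => ?_⟩
  rw [convection_eq hC hv hw hh, gradNorm_eq, gradNorm_eq, gradNorm_eq]
  have h1 := le_of_abs_le (abs_tensorForm_le hC hv hh w)
  have h2 := neg_le_of_abs_le (abs_tensorForm_le hC hv hw h)
  have h3 : 0 ≤ ‖v.2‖ * ‖w.2‖ * ‖h.2‖ := by positivity
  linarith

end Trilinear

/-! ### Linearity, skewness and bound of the convection form -/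

section Convection

variable (hd : d = 2 ∨ d = 3) (hΩb : Bornology.IsBounded Ω)
include hd hΩb

theorem convection_add_smul_left {u v w h : FieldPair Ω} (hu : u ∈ sobolevZero Ω)
    (hv : v ∈ sobolevZero Ω) (hw : w ∈ sobolevZero Ω) (hh : h ∈ sobolevZero Ω) (c : ℝ) :
    convection (u + c • v) w h = convection u w h + c * convection v w h := by
  obtain ⟨C, hC⟩ := exists_sobolev hd hΩb
  rw [convection_eq hC (add_mem hu (Submodule.smul_mem _ c hv)) hw hh, convection_eq hC hu hw hh,
    convection_eq hC hv hw hh, tensorForm_add_smul_left hC hu hv hh,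
    tensorForm_add_smul_left hC hu hv hw]
  ring

theorem convection_add_smul_mid {u v w h : FieldPair Ω} (hu : u ∈ sobolevZero Ω)
    (hv : v ∈ sobolevZero Ω) (hw : w ∈ sobolevZero Ω) (hh : h ∈ sobolevZero Ω) (c : ℝ) :
    convection u (v + c • w) h = convection u v h + c * convection u w h := by
  obtain ⟨C, hC⟩ := exists_sobolev hd hΩb
  rw [convection_eq hC hu (add_mem hv (Submodule.smul_mem _ c hw)) hh, convection_eq hC hu hv hh,
    convection_eq hC hu hw hh, tensorForm_add_smul_right hC hu hh,
    tensorForm_add_smul_mid hC hu hv hw]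
  ring

theorem convection_skew {u v w : FieldPair Ω} (hu : u ∈ sobolevZero Ω)
    (hv : v ∈ sobolevZero Ω) (hw : w ∈ sobolevZero Ω) :
    convection u v w = - convection u w v := by
  obtain ⟨C, hC⟩ := exists_sobolev hd hΩb
  rw [convection_eq hC hu hv hw, convection_eq hC hu hw hv]
  ring

theorem convection_self {u v : FieldPair Ω} (hu : u ∈ sobolevZero Ω) (hv : v ∈ sobolevZero Ω) :
    convection u v v = 0 := by
  have := convection_skew hd hΩb hu hv hv
  linarith

theorem convection_add_smul_right {u v w h : FieldPair Ω} (hu : u ∈ sobolevZero Ω)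
    (hv : v ∈ sobolevZero Ω) (hw : w ∈ sobolevZero Ω) (hh : h ∈ sobolevZero Ω) (c : ℝ) :
    convection u v (w + c • h) = convection u v w + c * convection u v h := by
  rw [convection_skew hd hΩb hu hv (add_mem hw (Submodule.smul_mem _ c hh)),
    convection_skew hd hΩb hu hv hw, convection_skew hd hΩb hu hv hh,
    convection_add_smul_mid hd hΩb hu hw hh hv]
  ring

theorem convection_sub_left {u v w h : FieldPair Ω} (hu : u ∈ sobolevZero Ω)
    (hv : v ∈ sobolevZero Ω) (hw : w ∈ sobolevZero Ω) (hh : h ∈ sobolevZero Ω) :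
    convection (u - v) w h = convection u w h - convection v w h := by
  have := convection_add_smul_left hd hΩb hu hv hw hh (-1)
  rw [neg_one_smul, ← sub_eq_add_neg] at this
  linarith

theorem convection_sub_mid {u v w h : FieldPair Ω} (hu : u ∈ sobolevZero Ω)
    (hv : v ∈ sobolevZero Ω) (hw : w ∈ sobolevZero Ω) (hh : h ∈ sobolevZero Ω) :
    convection u (v - w) h = convection u v h - convection u w h := by
  have := convection_add_smul_mid hd hΩb hu hv hw hh (-1)
  rw [neg_one_smul, ← sub_eq_add_neg] at this
  linarith

/-- Swapping the last two arguments changes the sign, so the one-sided bound applied to both orders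
is two-sided. -/
theorem abs_convection_le {C : ℝ} (hC : IsConvectionBound Ω C) {u v w : FieldPair Ω}
    (hu : u ∈ sobolevZero Ω) (hv : v ∈ sobolevZero Ω) (hw : w ∈ sobolevZero Ω) :
    |convection u v w| ≤ C * ‖u.2‖ * ‖v.2‖ * ‖w.2‖ := by
  have h1 := hC u hu v hv w hw
  have h2 := hC u hu w hw v hv
  rw [gradNorm_eq, gradNorm_eq, gradNorm_eq] at h1 h2
  rw [convection_skew hd hΩb hu hw hv] at h2
  rw [abs_le]
  constructor <;> linarith

end Convection

end Bingham

namespace Bingham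

variable {d : ℕ} {Ω : Set (Vec d)}

/-! ### Polynomial fields on a cell -/

section Polynomial

/-- The vector field with polynomial components `P`. -/
noncomputable def polyField (P : Fin d → MvPolynomial (Fin d) ℝ) (x : Vec d) : Vec d :=
  WithLp.toLp 2 fun k => MvPolynomial.eval (fun l => x l) (P k)

theorem continuous_polyField (P : Fin d → MvPolynomial (Fin d) ℝ) : Continuous (polyField P) := by
  refine (PiLp.continuous_toLp 2 (fun _ : Fin d => ℝ)).comp (continuous_pi fun k => ?_)
  exact (MvPolynomial.continuous_eval (P k)).comp (by fun_prop)

theorem isCompact_convexHull_finset (K : Finset (Vec d)) :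
    IsCompact (convexHull ℝ (K : Set (Vec d))) :=
  K.finite_toSet.isCompact_convexHull ℝ

theorem memLp_polyField {μ : Measure (Vec d)} [IsFiniteMeasure μ] (K : Finset (Vec d))
    (P : Fin d → MvPolynomial (Fin d) ℝ) : MemLp (polyField P) 2 (μ.restrict (openCell K)) := by
  obtain ⟨C, hC⟩ := (isCompact_convexHull_finset K).exists_bound_of_continuousOn
    (continuous_polyField P).continuousOn
  refine MemLp.of_bound (continuous_polyField P).aestronglyMeasurable C ?_
  refine ae_restrict_of_forall_mem isOpen_interior.measurableSet fun x hx => ?_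
  exact hC x (interior_subset hx)

/-- Polynomial vector fields as elements of `L²` of a cell. -/
noncomputable def polyLp (μ : Measure (Vec d)) [IsFiniteMeasure μ] (K : Finset (Vec d)) :
    (Fin d → MvPolynomial (Fin d) ℝ) →ₗ[ℝ] Lp (Vec d) 2 (μ.restrict (openCell K)) where
  toFun P := (memLp_polyField K P).toLp _
  map_add' P Q := by
    rw [← MemLp.toLp_add]
    congr 1
    ext x k
    simp [polyField]
  map_smul' c P := by
    rw [RingHom.id_apply, ← MemLp.toLp_const_smul]
    congr 1
    ext x k
    simp [polyField]

/-- Finite dimension makes the image of a local velocity space in L² of the cell closed. -/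
theorem finiteDimensional_of_totalDegree_le (N : ℕ)
    (S : Submodule ℝ (Fin d → MvPolynomial (Fin d) ℝ))
    (hS : ∀ P ∈ S, ∀ k, (P k).totalDegree ≤ N) : FiniteDimensional ℝ S := by
  let f : S →ₗ[ℝ] (Fin d → MvPolynomial.restrictTotalDegree (Fin d) ℝ N) :=
    { toFun := fun P k => ⟨P.1 k, (MvPolynomial.mem_restrictTotalDegree _ _ _).2 (hS P.1 P.2 k)⟩
      map_add' := fun P Q => rfl
      map_smul' := fun c P => rfl }
  refine FiniteDimensional.of_injective f fun P Q h => ?_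
  ext1
  funext k
  exact congrArg Subtype.val (congrFun h k)

end Polynomial

theorem openCell_subset {T : Triangulation Ω} {K : Finset (Vec d)} (hK : K ∈ T.cells) :
    openCell K ⊆ Ω := by
  rw [← T.interior_space]
  exact interior_mono (T.complex.convexHull_subset_space hK.1)

theorem isFiniteMeasure_restrict (hΩb : Bornology.IsBounded Ω) :
    IsFiniteMeasure (volume.restrict Ω : Measure (Vec d)) :=
  ⟨by simpa using hΩb.measure_lt_top⟩

/-! ### The discretely divergence-free space as a closed subspace -/

section Space

variable {T : Triangulation Ω} (S : LocalSpaces T)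

/-- Restriction of the function of a pair to a cell. -/
noncomputable def restrictCell (Ω : Set (Vec d)) (K : Finset (Vec d)) :
    FieldPair Ω →L[ℝ] Lp (Vec d) 2 ((volume.restrict Ω).restrict (openCell K)) :=
  (LpToLpRestrictCLM (Vec d) (Vec d) ℝ (volume.restrict Ω) 2 (openCell K)).comp
    (ContinuousLinearMap.fst ℝ _ _)

/-- Turns the condition on one cell into a preimage under continuous restriction, so that linearity
and closedness can be read off. -/
theorem exists_poly_iff [IsFiniteMeasure (volume.restrict Ω : Measure (Vec d))]
    {K : Finset (Vec d)} (hK : K ∈ T.cells) (V : FieldPair Ω) :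
    (∃ P ∈ S.vel K, ∀ᵐ x ∂(volume.restrict (openCell K)),
      V.1 x = WithLp.toLp 2 fun k => MvPolynomial.eval (fun l => x l) (P k)) ↔
    V ∈ ((S.vel K).map (polyLp (volume.restrict Ω) K)).comap
      (restrictCell Ω K : FieldPair Ω →ₗ[ℝ] _) := by
  rw [Submodule.mem_comap, Submodule.mem_map]
  refine exists_congr fun P => and_congr_right fun _ => ?_
  have hμ : (volume.restrict Ω).restrict (openCell K) = volume.restrict (openCell K) :=
    Measure.restrict_restrict_of_subset (openCell_subset hK)
  rw [Lp.ext_iff, ← hμ]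
  have h1 : polyLp (volume.restrict Ω) K P =ᵐ[(volume.restrict Ω).restrict (openCell K)]
    polyField P := MemLp.coeFn_toLp (memLp_polyField K P)
  have h2 : (restrictCell Ω K V) =ᵐ[(volume.restrict Ω).restrict (openCell K)] V.1 :=
    LpToLpRestrictCLM_coeFn ℝ _ _
  constructor
  · intro h
    filter_upwards [h, h1, h2] with x h h1 h2
    rw [h1, ContinuousLinearMap.coe_coe, h2, h]
    rfl
  · intro h
    filter_upwards [h, h1, h2] with x h h1 h2
    rw [ContinuousLinearMap.coe_coe, h2] at h
    rw [← h, h1]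
    rfl

/-- The matrix field `Q I`. -/
noncomputable def scalarField (Q : Vec d → ℝ) (x : Vec d) : Mat d :=
  Q x • WithLp.toLp 2 fun p : Fin d × Fin d => if p.1 = p.2 then 1 else 0

theorem inner_scalarField (Q : Vec d → ℝ) (x : Vec d) (G : Mat d) :
    inner ℝ (scalarField Q x) G = Q x * ∑ i, G (i, i) := by
  rw [scalarField, real_inner_smul_left, PiLp.inner_apply, Fintype.sum_prod_type]
  simp

theorem memLp_scalarField [IsFiniteMeasure (volume.restrict Ω : Measure (Vec d))]
    (Q : Lp ℝ ⊤ (volume.restrict Ω)) : MemLp (scalarField Q) 2 (volume.restrict Ω) := by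
  have h : MemLp Q 2 (volume.restrict Ω) := (Lp.memLp Q).mono_exponent le_top
  exact (ContinuousLinearMap.smulRight (1 : ℝ →L[ℝ] ℝ) (WithLp.toLp 2
    fun p : Fin d × Fin d => if p.1 = p.2 then 1 else 0 : Mat d)).comp_memLp' h

/-- Since Q div V = (Q I) : ∇V, each constraint is orthogonality to a fixed L² field; Q lies in L²
because Ω has finite measure. -/
theorem integral_mul_div_eq [IsFiniteMeasure (volume.restrict Ω : Measure (Vec d))]
    (Q : Lp ℝ ⊤ (volume.restrict Ω)) (V : FieldPair Ω) :
    ∫ x in Ω, Q x * ∑ i, V.2 x (i, i) = inner ℝ ((memLp_scalarField Q).toLp _) V.2 := by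
  rw [L2.inner_def]
  refine integral_congr_ae ?_
  filter_upwards [(memLp_scalarField Q).coeFn_toLp] with x hx
  rw [hx, inner_scalarField]

/-- The discretely divergence-free space is a closed subspace. -/
theorem exists_closed_submodule (hΩb : Bornology.IsBounded Ω) :
    ∃ X : Submodule ℝ (FieldPair Ω), (X : Set (FieldPair Ω)) = divFreeSpace S ∧
      IsClosed (X : Set (FieldPair Ω)) := by
  have := isFiniteMeasure_restrict hΩb
  refine ⟨sobolevZero Ω ⊓
    (⨅ K ∈ T.cells, ((S.vel K).map (polyLp (volume.restrict Ω) K)).comap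
      (restrictCell Ω K : FieldPair Ω →ₗ[ℝ] _)) ⊓
    ⨅ Q ∈ pressureSpace S, LinearMap.ker (((innerSL ℝ ((memLp_scalarField Q).toLp _)).comp
      (ContinuousLinearMap.snd ℝ (Lp (Vec d) 2 (volume.restrict Ω))
        (Lp (Mat d) 2 (volume.restrict Ω)))).toLinearMap), ?_, ?_⟩
  · ext V
    simp only [SetLike.mem_coe, Submodule.mem_inf, Submodule.mem_iInf, divFreeSpace, velocitySpace,
      Set.mem_ofPred_eq, LinearMap.mem_ker]
    refine and_congr (and_congr_right fun _ => ?_) ?_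
    · exact forall_congr' fun K => forall_congr' fun hK => (exists_poly_iff S hK V).symm
    · refine forall_congr' fun Q => forall_congr' fun _ => ?_
      rw [integral_mul_div_eq]
      rfl
  · simp only [Submodule.coe_inf, Submodule.coe_iInf]
    refine ((Submodule.isClosed_topologicalClosure _).inter ?_).inter ?_
    · refine isClosed_biInter fun K hK => ?_
      have := finiteDimensional_of_totalDegree_le S.velDeg (S.vel K) (S.vel_le K hK)
      exact (Submodule.closed_of_finiteDimensional
        ((S.vel K).map (polyLp (volume.restrict Ω) K))).preimage (restrictCell Ω K).continuous
    · exact isClosed_biInter fun Q hQ => ContinuousLinearMap.isClosed_ker _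

end Space

/-! ### The Hilbert space of symmetric gradients -/

section Range

/-- The symmetric gradient on a subspace of pairs. -/
noncomputable def symOn (X : Submodule ℝ (FieldPair Ω)) :
    X →L[ℝ] Lp (Mat d) 2 (volume.restrict Ω) :=
  ((symLp Ω).comp (ContinuousLinearMap.snd ℝ _ _)).comp X.subtypeL

theorem symOn_apply (X : Submodule ℝ (FieldPair Ω)) (V : X) :
    symOn X V = symLp Ω (V : FieldPair Ω).2 := rfl

theorem norm_snd_le {U : FieldPair Ω} (hU : U ∈ sobolevZero Ω) :
    ‖U.2‖ ≤ √2 * ‖symLp Ω U.2‖ := by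
  refine le_of_sq_le_sq ?_ (by positivity)
  rw [mul_pow, Real.sq_sqrt (by norm_num)]
  exact korn hU

/-- Poincaré bounds the function by its gradient and Korn the gradient by its symmetric part. This
yields both injectivity and closed range. -/
theorem exists_antilipschitz_symOn (hd : d = 2 ∨ d = 3) (hΩb : Bornology.IsBounded Ω)
    {X : Submodule ℝ (FieldPair Ω)} (hX : X ≤ sobolevZero Ω) :
    ∃ C : NNReal, AntilipschitzWith C (symOn X) := by
  obtain ⟨C, hC0, hC⟩ := exists_poincare hd hΩb
  refine ⟨Real.toNNReal ((C + 1) * √2), ContinuousLinearMap.antilipschitz_of_bound _ fun V => ?_⟩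
  rw [Real.coe_toNNReal _ (by positivity), symOn_apply]
  have h1 := hC V (hX V.2)
  have h2 := norm_snd_le (hX V.2)
  have h3 : ‖(V : FieldPair Ω)‖ ≤ (C + 1) * ‖(V : FieldPair Ω).2‖ := by
    rw [Prod.norm_def]
    refine max_le ?_ ?_ <;> nlinarith [norm_nonneg (V : FieldPair Ω).2]
  calc ‖V‖ = ‖(V : FieldPair Ω)‖ := rfl
    _ ≤ _ := h3
    _ ≤ (C + 1) * (√2 * ‖symLp Ω (V : FieldPair Ω).2‖) := by gcongr
    _ = _ := by ring

/-- The space of symmetric gradients of a subspace of pairs, a subspace of `L²`. -/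
noncomputable abbrev symRange (X : Submodule ℝ (FieldPair Ω)) :
    Submodule ℝ (Lp (Mat d) 2 (volume.restrict Ω)) :=
  LinearMap.range (symOn X).toLinearMap

theorem completeSpace_symRange (hd : d = 2 ∨ d = 3) (hΩb : Bornology.IsBounded Ω)
    {X : Submodule ℝ (FieldPair Ω)} (hX : X ≤ sobolevZero Ω)
    (hXc : IsClosed (X : Set (FieldPair Ω))) : CompleteSpace (symRange X) := by
  obtain ⟨C, hC⟩ := exists_antilipschitz_symOn hd hΩb hX
  have : CompleteSpace X := hXc.completeSpace_coe
  have h : IsClosed (Set.range (symOn X)) := hC.isClosed_range (symOn X).uniformContinuous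
  have h' : IsClosed (symRange X : Set (Lp (Mat d) 2 (volume.restrict Ω))) := h
  exact h'.completeSpace_coe

/-- A subspace of `W_0^{1,2}` is isomorphic to its space of symmetric gradients. -/
theorem exists_equiv_symRange (hd : d = 2 ∨ d = 3) (hΩb : Bornology.IsBounded Ω)
    {X : Submodule ℝ (FieldPair Ω)} (hX : X ≤ sobolevZero Ω) :
    ∃ e : X ≃ₗ[ℝ] symRange X, ∀ V : X, (e V : Lp (Mat d) 2 (volume.restrict Ω)) =
      symLp Ω (V : FieldPair Ω).2 := by
  obtain ⟨C, hC⟩ := exists_antilipschitz_symOn hd hΩb hX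
  exact ⟨LinearEquiv.ofInjective (symOn X).toLinearMap hC.injective, fun V => rfl⟩

end Range

end Bingham

namespace Bingham

variable {d : ℕ} {Ω : Set (Vec d)}

/-! ### Riesz representation of nonlinear operators -/

section Riesz

variable {H : Type*} [NormedAddCommGroup H] [InnerProductSpace ℝ H]

theorem exists_riesz [CompleteSpace H] (ℓ : H → ℝ) (K : ℝ)
    (hlin : ∀ u v c, ℓ (u + c • v) = ℓ u + c * ℓ v) (hK : ∀ w, |ℓ w| ≤ K * ‖w‖) :
    ∃ a : H, ∀ w, inner ℝ a w = ℓ w := by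
  have h0 : ℓ 0 = 0 := by
    have := hlin 0 0 1
    simp only [smul_zero, add_zero, one_mul] at this
    linarith
  let L : H →ₗ[ℝ] ℝ :=
    { toFun := ℓ
      map_add' := fun u v => by simpa using hlin u v 1
      map_smul' := fun c v => by simpa [h0] using hlin 0 v c }
  exact ⟨(InnerProductSpace.toDual ℝ H).symm (L.mkContinuous K hK), fun w =>
    InnerProductSpace.toDual_symm_apply⟩

theorem norm_le_of_inner_le {a : H} {K : ℝ} (hK0 : 0 ≤ K) (h : ∀ w, inner ℝ a w ≤ K * ‖w‖) :
    ‖a‖ ≤ K := by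
  have h1 := h a
  rw [real_inner_self_eq_norm_sq] at h1
  rcases (norm_nonneg a).eq_or_lt with h0 | h0
  · rwa [← h0]
  · exact le_of_mul_le_mul_right (by linarith) h0

theorem eq_sub_of_inner {a b c : H} (h : ∀ w, inner ℝ a w = inner ℝ b w - inner ℝ c w) :
    a = b - c :=
  ext_inner_right ℝ fun w => by rw [h, inner_sub_left]

/-- A strongly monotone Lipschitz map pulled back along an isometry. -/
theorem exists_pullback [CompleteSpace H] {K : Type*} [NormedAddCommGroup K]
    [InnerProductSpace ℝ K] (J : H →ₗ[ℝ] K) (hJ : ∀ u v, inner ℝ (J u) (J v) = inner ℝ u v)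
    (N : K → K) {m L : ℝ} (hL : 0 ≤ L)
    (hN : ∀ x y, m * ‖x - y‖ ^ 2 ≤ inner ℝ (N x - N y) (x - y))
    (hNL : ∀ x y, ‖N x - N y‖ ≤ L * ‖x - y‖) (hN0 : N 0 = 0) :
    ∃ A : H → H, (∀ u w, inner ℝ (A u) w = inner ℝ (N (J u)) (J w)) ∧
      (∀ u v, m * ‖u - v‖ ^ 2 ≤ inner ℝ (A u - A v) (u - v)) ∧
      (∀ u v, ‖A u - A v‖ ≤ L * ‖u - v‖) ∧ A 0 = 0 := by
  have hnorm : ∀ u, ‖J u‖ = ‖u‖ := fun u => by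
    rw [← Real.sqrt_sq (norm_nonneg (J u)), ← real_inner_self_eq_norm_sq, hJ,
      real_inner_self_eq_norm_sq, Real.sqrt_sq (norm_nonneg u)]
  have hA : ∀ u : H, ∃ a : H, ∀ w, inner ℝ a w = inner ℝ (N (J u)) (J w) := by
    intro u
    refine exists_riesz _ ‖N (J u)‖ (fun v w c => ?_) fun w => ?_
    · rw [map_add, map_smul, inner_add_right, inner_smul_right]
    · rw [← hnorm w]
      exact abs_real_inner_le_norm _ _
  choose A hA using hA
  have hAsub : ∀ u v w, inner ℝ (A u - A v) w = inner ℝ (N (J u) - N (J v)) (J w) := by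
    intro u v w
    rw [inner_sub_left, inner_sub_left, hA, hA]
  refine ⟨A, hA, fun u v => ?_, fun u v => ?_, ?_⟩
  · rw [hAsub, ← hnorm, map_sub]
    exact hN _ _
  · refine norm_le_of_inner_le (by positivity) fun w => ?_
    rw [hAsub, ← hnorm w, ← hnorm (u - v), map_sub]
    refine (real_inner_le_norm _ _).trans ?_
    exact mul_le_mul_of_nonneg_right (hNL _ _) (norm_nonneg _)
  · refine ext_inner_right ℝ fun w => ?_
    rw [hA, map_zero, hN0, inner_zero_left, inner_zero_left]

end Riesz

theorem load_eq (f : Lp (Vec d) 2 (volume.restrict Ω)) (V : FieldPair Ω) :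
    load f V = inner ℝ f V.1 := by
  rw [load, L2.inner_def]

/-! ### Viscosity and convection as operators on the Hilbert space -/

section Operator

variable {H : Type*} [NormedAddCommGroup H] [InnerProductSpace ℝ H] {l : H →ₗ[ℝ] FieldPair Ω}
  (hl : ∀ z, l z ∈ sobolevZero Ω)
  (hsym : ∀ u v, inner ℝ (symLp Ω (l u).2) (symLp Ω (l v).2) = inner ℝ u v)
include hsym

theorem norm_symLp_comp (u : H) : ‖symLp Ω (l u).2‖ = ‖u‖ := by
  rw [← Real.sqrt_sq (norm_nonneg (symLp Ω (l u).2)), ← real_inner_self_eq_norm_sq, hsym,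
    real_inner_self_eq_norm_sq, Real.sqrt_sq (norm_nonneg u)]

theorem exists_viscousOperator [CompleteSpace H] {σ ν : ℝ} (hσ : 0 ≤ σ) (hν : 0 < ν) {n : ℕ}
    (hn : 1 ≤ n) : ∃ A : H → H,
      (∀ u w, inner ℝ (A u) w = viscousForm σ ν n (l u) (l u) (l w)) ∧
      (∀ u v, 2 * ν * ‖u - v‖ ^ 2 ≤ inner ℝ (A u - A v) (u - v)) ∧
      (∀ u v, ‖A u - A v‖ ≤ (σ * n + 2 * ν) * ‖u - v‖) ∧ A 0 = 0 := by
  obtain ⟨A, hA, h⟩ := exists_pullback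
    ((symLp Ω).toLinearMap ∘ₗ LinearMap.snd ℝ (Lp (Vec d) 2 (volume.restrict Ω)) _ ∘ₗ l) hsym
    (stressLp hσ hν hn) (by positivity) (stressLp_mono hσ hν hn) (norm_stressLp_sub_le hσ hν hn)
    (stressLp_zero hσ hν hn)
  refine ⟨A, fun u w => ?_, h⟩
  rw [viscousForm_eq hσ hν hn, hA]
  rfl

variable (hd : d = 2 ∨ d = 3) (hΩb : Bornology.IsBounded Ω) {C : ℝ} (hC0 : 0 < C)
  (hC : IsConvectionBound Ω C)
include hl hd hΩb hC0 hC

/-- Korn costs a factor √2 in each of the three arguments: C(√2)³ = 2(√2 C). -/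
theorem abs_convection_comp_le (u v w : H) :
    |convection (l u) (l v) (l w)| ≤ 2 * (√2 * C) * ‖u‖ * ‖v‖ * ‖w‖ := by
  have hs2 : √2 ^ 2 = 2 := Real.sq_sqrt (by norm_num)
  refine (abs_convection_le hd hΩb hC (hl u) (hl v) (hl w)).trans ?_
  have hln : ∀ z, ‖(l z).2‖ ≤ √2 * ‖z‖ := fun z => by
    rw [← norm_symLp_comp hsym z]
    exact norm_snd_le (hl z)
  have hu := hln u
  have hv := hln v
  have hw := hln w
  calc _ ≤ C * (√2 * ‖u‖) * (√2 * ‖v‖) * (√2 * ‖w‖) := by gcongr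
    _ = √2 ^ 2 * (√2 * C) * ‖u‖ * ‖v‖ * ‖w‖ := by ring
    _ = _ := by rw [hs2]

theorem exists_convectionOperator [CompleteSpace H] : ∃ b : H → H → H,
      (∀ u v w, inner ℝ (b u v) w = convection (l u) (l v) (l w)) ∧
      (∀ u v w, b (u - v) w = b u w - b v w) ∧ (∀ u v w, b u (v - w) = b u v - b u w) ∧
      (∀ u v, inner ℝ (b u v) v = 0) ∧ ∀ u v, ‖b u v‖ ≤ 2 * (√2 * C) * ‖u‖ * ‖v‖ := by
  have hbound := abs_convection_comp_le hl hsym hd hΩb hC0 hC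
  have hb : ∀ u v : H, ∃ a : H, ∀ w : H, inner ℝ a w = convection (l u) (l v) (l w) := by
    intro u v
    refine exists_riesz _ (2 * (√2 * C) * ‖u‖ * ‖v‖) (fun w h c => ?_) (hbound u v)
    rw [l.map_add, l.map_smul]
    exact convection_add_smul_right hd hΩb (hl u) (hl v) (hl w) (hl h) c
  choose b hb using hb
  refine ⟨b, hb, fun u v w => ?_, fun u v w => ?_, fun u v => ?_, fun u v => ?_⟩
  · refine eq_sub_of_inner fun h => ?_
    rw [hb, hb, hb, l.map_sub]
    exact convection_sub_left hd hΩb (hl u) (hl v) (hl w) (hl h)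
  · refine eq_sub_of_inner fun h => ?_
    rw [hb, hb, hb, l.map_sub]
    exact convection_sub_mid hd hΩb (hl u) (hl v) (hl w) (hl h)
  · rw [hb]
    exact convection_self hd hΩb (hl u) (hl v)
  · refine norm_le_of_inner_le (by positivity) fun w => ?_
    rw [hb]
    exact le_of_abs_le (hbound u v w)

/-- The viscous and convective parts of the Bingham operator, represented in a Hilbert space of
velocity fields. -/
theorem exists_convectiveOperator [CompleteSpace H] {σ ν : ℝ} (hσ : 0 ≤ σ) (hν : 0 < ν) {n : ℕ}
    (hn : 1 ≤ n) : ∃ (A : H → H) (b : H → H → H), ConvectiveOperator A b ν (σ * n) (√2 * C) ∧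
      (∀ u w, inner ℝ (A u) w = viscousForm σ ν n (l u) (l u) (l w)) ∧
      ∀ u v w, inner ℝ (b u v) w = convection (l u) (l v) (l w) := by
  obtain ⟨A, hA, hA1, hA2, hA3⟩ := exists_viscousOperator hsym hσ hν hn
  obtain ⟨b, hb, hb1, hb2, hb3, hb4⟩ := exists_convectionOperator hl hsym hd hΩb hC0 hC
  exact ⟨A, b, ⟨hν, by positivity, by positivity, hA1, hA2, hA3, hb1, hb2, hb3, hb4⟩, hA, hb⟩

end Operator

/-! ### The dual norm of the load -/

section Load

variable {T : Triangulation Ω} (S : LocalSpaces T) (f : Lp (Vec d) 2 (volume.restrict Ω))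

theorem divFreeSpace_subset : divFreeSpace S ⊆ sobolevZero Ω := fun _ hV => hV.1.1

variable (hd : d = 2 ∨ d = 3) (hΩb : Bornology.IsBounded Ω)
include hd hΩb

theorem symNorm_pos {V : FieldPair Ω} (hV : V ∈ sobolevZero Ω) (h0 : V ≠ 0) : 0 < symNorm V := by
  rw [symNorm_eq]
  refine norm_pos_iff.2 fun h => h0 ?_
  obtain ⟨C, -, hC⟩ := exists_poincare hd hΩb
  have h1 := norm_snd_le hV
  rw [h, norm_zero, mul_zero] at h1
  have h2 : V.2 = 0 := norm_le_zero_iff.1 h1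
  have h3 := hC V hV
  rw [h2, norm_zero, mul_zero] at h3
  exact Prod.ext (norm_le_zero_iff.1 h3) h2

theorem load_le_loadNorm_mul {V : FieldPair Ω} (hV : V ∈ divFreeSpace S) :
    load f V ≤ loadNorm S f * symNorm V := by
  rcases eq_or_ne V 0 with rfl | h0
  · rw [load_eq, symNorm_eq]
    simp
  · have hpos := symNorm_pos hd hΩb (divFreeSpace_subset S hV) h0
    rw [← div_le_iff₀ hpos]
    -- A real supremum dominates its set only if the set is bounded above; Poincaré and Korn provide
    -- the bound.
    refine le_csSup ?_ ⟨V, hV, h0, rfl⟩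
    obtain ⟨C, hC0, hC⟩ := exists_poincare hd hΩb
    refine ⟨‖f‖ * (C * √2), ?_⟩
    rintro c ⟨W, hW, hW0, rfl⟩
    have hWs := divFreeSpace_subset S hW
    rw [div_le_iff₀ (symNorm_pos hd hΩb hWs hW0), load_eq, symNorm_eq]
    calc inner ℝ f W.1 ≤ ‖f‖ * ‖W.1‖ := real_inner_le_norm _ _
      _ ≤ ‖f‖ * (C * (√2 * ‖symLp Ω W.2‖)) := by
        have h1 := hC W hWs
        have h2 := norm_snd_le hWs
        gcongr
        exact h1.trans (mul_le_mul_of_nonneg_left h2 hC0)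
      _ = _ := by ring

/-- V and -V both compete in the supremum; if there is no nonzero field, the real supremum of the
empty set is 0. -/
theorem loadNorm_nonneg : 0 ≤ loadNorm S f := by
  obtain ⟨X, hX, -⟩ := exists_closed_submodule S hΩb
  by_cases h : ∃ V ∈ divFreeSpace S, V ≠ 0
  · obtain ⟨V, hV, h0⟩ := h
    have hneg : -V ∈ divFreeSpace S := by
      rw [← hX] at hV ⊢
      exact neg_mem hV
    have h1 := load_le_loadNorm_mul S f hd hΩb hV
    have h2 := load_le_loadNorm_mul S f hd hΩb hneg
    have hpos := symNorm_pos hd hΩb (divFreeSpace_subset S hV) h0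
    have h3 : symNorm (-V) = symNorm V := by
      rw [symNorm_eq, symNorm_eq, Prod.snd_neg, map_neg, norm_neg]
    have h4 : load f (-V) = - load f V := by
      rw [load_eq, load_eq, Prod.fst_neg, inner_neg_right]
    rw [h3, h4] at h2
    by_contra hc
    push Not at hc
    nlinarith
  · have : {c | ∃ V ∈ divFreeSpace S, V ≠ 0 ∧ c = load f V / symNorm V} = ∅ := by
      ext c
      simp only [Set.mem_ofPred_eq, Set.mem_empty_iff_false, iff_false]
      rintro ⟨V, hV, h0, -⟩
      exact h ⟨V, hV, h0⟩
    rw [loadNorm, this, Real.sSup_empty]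

end Load

/-! ### Strong monotonicity and Lipschitz continuity in the gradient norm -/

section Estimates

theorem norm_snd_le_of_mem_ball {T : Triangulation Ω} {S : LocalSpaces T} {R : ℝ}
    {U : FieldPair Ω} (hU : U ∈ ball S R) : ‖U.2‖ ≤ √2 * R := by
  refine (norm_snd_le (divFreeSpace_subset S hU.1)).trans ?_
  rw [← symNorm_eq]
  exact mul_le_mul_of_nonneg_left hU.2 (Real.sqrt_nonneg 2)


variable {T : Triangulation Ω} {S : LocalSpaces T} {f : Lp (Vec d) 2 (volume.restrict Ω)}
  (hd : d = 2 ∨ d = 3) (hΩb : Bornology.IsBounded Ω) {C : ℝ} (hC0 : 0 < C)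
  (hC : IsConvectionBound Ω C) {σ ν : ℝ} (hσ : 0 ≤ σ) (hν : 0 < ν) {n : ℕ} (hn : 1 ≤ n) {R : ℝ}
include hd hΩb hσ hν hn

/-- The convective difference is split so that its last term vanishes for W = U - V. -/
theorem binghamOp_sub {U V W : FieldPair Ω} (hU : U ∈ sobolevZero Ω) (hV : V ∈ sobolevZero Ω)
    (hW : W ∈ sobolevZero Ω) :
    binghamOp σ ν n f U W - binghamOp σ ν n f V W =
      inner ℝ (stressLp hσ hν hn (symLp Ω U.2) - stressLp hσ hν hn (symLp Ω V.2)) (symLp Ω W.2) +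
        (convection (U - V) U W + convection V (U - V) W) := by
  rw [binghamOp, binghamOp, viscousForm_eq hσ hν hn, viscousForm_eq hσ hν hn, inner_sub_left,
    convection_sub_left hd hΩb hU hV hU hW, convection_sub_mid hd hΩb hV hU hV hW]
  ring

include hC0 hC

/-- Korn turns 2ν times the squared symmetric norm into ν times the squared gradient norm. The
surviving convective term costs at most C‖∇U‖ ≤ √2CR. -/
theorem binghamOp_strongly_monotone {U V : FieldPair Ω} (hU : U ∈ ball S R) (hV : V ∈ ball S R) :
    (ν - √2 * C * R) * gradNorm (U - V) ^ 2 ≤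
      binghamOp σ ν n f U (U - V) - binghamOp σ ν n f V (U - V) := by
  have hUs := divFreeSpace_subset S hU.1
  have hVs := divFreeSpace_subset S hV.1
  have hE : U - V ∈ sobolevZero Ω := sub_mem hUs hVs
  rw [binghamOp_sub hd hΩb hσ hν hn hUs hVs hE, convection_self hd hΩb hVs hE, gradNorm_eq]
  have h1 := stressLp_mono hσ hν hn (symLp Ω U.2) (symLp Ω V.2)
  have h2 := korn hE
  have h3 := neg_le_of_abs_le (abs_convection_le hd hΩb hC hE hUs hE)
  have h4 := norm_snd_le_of_mem_ball hU
  rw [← map_sub, ← Prod.snd_sub] at h1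
  have h5 : C * ‖(U - V).2‖ * ‖U.2‖ * ‖(U - V).2‖ ≤ √2 * C * R * ‖(U - V).2‖ ^ 2 := by
    have := mul_le_mul_of_nonneg_left h4 (by positivity : 0 ≤ C * ‖(U - V).2‖ ^ 2)
    linarith
  have h6 := mul_le_mul_of_nonneg_left h2 hν.le
  linarith

theorem abs_binghamOp_sub_le {U V W : FieldPair Ω} (hU : U ∈ ball S R) (hV : V ∈ ball S R)
    (hW : W ∈ divFreeSpace S) :
    |binghamOp σ ν n f U W - binghamOp σ ν n f V W| ≤
      (√3 * σ * n + 2 * ν + 2 * √2 * C * R) * gradNorm (U - V) * gradNorm W := by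
  have hUs := divFreeSpace_subset S hU.1
  have hVs := divFreeSpace_subset S hV.1
  have hWs := divFreeSpace_subset S hW
  have hE : U - V ∈ sobolevZero Ω := sub_mem hUs hVs
  rw [binghamOp_sub hd hΩb hσ hν hn hUs hVs hWs, gradNorm_eq, gradNorm_eq]
  set E := U - V with hEdef
  have h1 : |inner ℝ (stressLp hσ hν hn (symLp Ω U.2) - stressLp hσ hν hn (symLp Ω V.2))
      (symLp Ω W.2)| ≤ (σ * n + 2 * ν) * ‖E.2‖ * ‖W.2‖ := by
    refine (abs_real_inner_le_norm _ _).trans ?_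
    have h2 := norm_stressLp_sub_le hσ hν hn (symLp Ω U.2) (symLp Ω V.2)
    rw [← map_sub, ← Prod.snd_sub, ← hEdef] at h2
    have h3 := norm_symLp_le E.2
    have h4 := norm_symLp_le W.2
    have h5 : 0 ≤ σ * n + 2 * ν := by positivity
    exact mul_le_mul (h2.trans (mul_le_mul_of_nonneg_left h3 h5)) h4 (norm_nonneg _) (by positivity)
  have h3 := abs_convection_le hd hΩb hC hE hUs hWs
  have h4 := abs_convection_le hd hΩb hC hVs hE hWs
  have h5 := norm_snd_le_of_mem_ball hU
  have h6 := norm_snd_le_of_mem_ball hV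
  have h7 := mul_le_mul_of_nonneg_left h5 (by positivity : 0 ≤ C * ‖E.2‖ * ‖W.2‖)
  have h8 := mul_le_mul_of_nonneg_left h6 (by positivity : 0 ≤ C * ‖E.2‖ * ‖W.2‖)
  -- The stress estimate gives σn; the factor √3 in the claimed constant is slack.
  have h9 : σ * n * (‖E.2‖ * ‖W.2‖) ≤ √3 * σ * n * (‖E.2‖ * ‖W.2‖) := by
    have : 1 ≤ √3 := Real.one_le_sqrt.2 (by norm_num)
    refine mul_le_mul_of_nonneg_right ?_ (by positivity)
    rw [mul_assoc]
    exact le_mul_of_one_le_left (by positivity) this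
  refine (abs_add_le _ _).trans ((add_le_add h1 (abs_add_le _ _)).trans ?_)
  linarith

end Estimates

end Bingham

namespace Bingham

variable {d : ℕ} {Ω : Set (Vec d)}

/-- The interval for R says (2βR - ν)² ≤ ν² - 2βF. Expanding gives F ≤ 2R(ν - βR), the form in which
the radius is used. -/
theorem radius_facts {ν β R F : ℝ} (hβ : 0 < β) (hν : 0 < ν) (hF0 : 0 ≤ F)
    (hF : 2 * β * F < ν ^ 2) (hlo : (ν - √(ν ^ 2 - 2 * β * F)) / (2 * β) ≤ R)
    (hhi : R ≤ (ν + √(ν ^ 2 - 2 * β * F)) / (2 * β)) :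
    β * R ≤ ν ∧ β * F ≤ 2 * (β * R * (ν - β * R)) := by
  rw [div_le_iff₀ (by positivity)] at hlo
  rw [le_div_iff₀ (by positivity)] at hhi
  have h1 : √(ν ^ 2 - 2 * β * F) ^ 2 = ν ^ 2 - 2 * β * F := Real.sq_sqrt (by linarith)
  have h2 : √(ν ^ 2 - 2 * β * F) ≤ ν := by
    rw [Real.sqrt_le_left hν.le]
    nlinarith
  set D := √(ν ^ 2 - 2 * β * F)
  constructor
  · linarith
  · have h3 : (2 * (β * R) - ν) ^ 2 ≤ D ^ 2 := sq_le_sq' (by linarith) (by linarith)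
    nlinarith

/-! ### Transfer to the Hilbert space and conclusion -/

section Solve

variable {T : Triangulation Ω} (S : LocalSpaces T) (f : Lp (Vec d) 2 (volume.restrict Ω))
  (hd : d = 2 ∨ d = 3) (hΩb : Bornology.IsBounded Ω)
include hd hΩb

/-- The discretely divergence-free space with the inner product of symmetric gradients is a Hilbert
space. -/
theorem exists_hilbert : ∃ (H : Type) (_ : NormedAddCommGroup H) (_ : InnerProductSpace ℝ H)
    (l : H →ₗ[ℝ] FieldPair Ω), CompleteSpace H ∧ (∀ V, V ∈ divFreeSpace S ↔ ∃ z, l z = V) ∧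
      ∀ u v, inner ℝ (symLp Ω (l u).2) (symLp Ω (l v).2) = inner ℝ u v := by
  obtain ⟨X, hX, hXc⟩ := exists_closed_submodule S hΩb
  have hXs : X ≤ sobolevZero Ω := by
    intro V hV
    exact divFreeSpace_subset S (hX ▸ hV)
  obtain ⟨e, he⟩ := exists_equiv_symRange hd hΩb hXs
  have hcomp := completeSpace_symRange hd hΩb hXs hXc
  refine ⟨symRange X, inferInstance, inferInstance, X.subtype ∘ₗ e.symm.toLinearMap, hcomp,
    fun V => ⟨fun hV => ?_, ?_⟩, fun u v => ?_⟩
  · rw [← hX] at hV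
    exact ⟨e ⟨V, hV⟩, congrArg Subtype.val (e.symm_apply_apply ⟨V, hV⟩)⟩
  · rintro ⟨z, rfl⟩
    rw [← hX]
    exact (e.symm z).2
  · have h : ∀ z, symLp Ω (e.symm z : FieldPair Ω).2 = z := fun z => by
      rw [← he, e.apply_symm_apply]
    exact congrArg₂ (inner ℝ) (h u) (h v)

/-- The discrete Bingham problem, represented as an equation in a Hilbert space. -/
theorem exists_representation {C : ℝ} (hC0 : 0 < C) (hC : IsConvectionBound Ω C) {σ ν : ℝ}
    (hσ : 0 ≤ σ) (hν : 0 < ν) {n : ℕ} (hn : 1 ≤ n) :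
    ∃ (H : Type) (_ : NormedAddCommGroup H) (_ : InnerProductSpace ℝ H)
      (l : H →ₗ[ℝ] FieldPair Ω) (A : H → H) (b : H → H → H) (g : H), CompleteSpace H ∧
      (∀ V, V ∈ divFreeSpace S ↔ ∃ z, l z = V) ∧
      (∀ u v, inner ℝ (symLp Ω (l u).2) (symLp Ω (l v).2) = inner ℝ u v) ∧
      ConvectiveOperator A b ν (σ * n) (√2 * C) ∧
      (∀ u w, inner ℝ (A u + b u u - g) w = binghamOp σ ν n f (l u) (l w)) ∧
      ‖g‖ ≤ loadNorm S f := by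
  obtain ⟨H, _, _, l, hcomp, hmem, hsym⟩ := exists_hilbert S hd hΩb
  have hin : ∀ w, l w ∈ divFreeSpace S := fun w => (hmem _).2 ⟨w, rfl⟩
  have hl : ∀ w, l w ∈ sobolevZero Ω := fun w => divFreeSpace_subset S (hin w)
  obtain ⟨A, b, hAb, hA, hb⟩ := exists_convectiveOperator hl hsym hd hΩb hC0 hC hσ hν hn
  have hload : ∀ w, |load f (l w)| ≤ loadNorm S f * ‖w‖ := by
    intro w
    have h1 : ∀ w, load f (l w) ≤ loadNorm S f * ‖w‖ := by
      intro w
      have := load_le_loadNorm_mul S f hd hΩb (hin w)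
      rwa [symNorm_eq, norm_symLp_comp hsym] at this
    have h2 := h1 (-w)
    rw [l.map_neg, norm_neg, load_eq, Prod.fst_neg, inner_neg_right, ← load_eq] at h2
    exact abs_le.2 ⟨by linarith, h1 w⟩
  obtain ⟨g, hg⟩ := exists_riesz (fun w => load f (l w)) (loadNorm S f) (fun u v c => by
    rw [l.map_add, l.map_smul, load_eq, load_eq, load_eq, Prod.fst_add, Prod.smul_fst,
      inner_add_right, inner_smul_right]) hload
  refine ⟨H, _, _, l, A, b, g, hcomp, hmem, hsym, hAb, fun u w => ?_, ?_⟩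
  · rw [inner_sub_left, inner_add_left, hA, hb, hg, binghamOp]
  · refine norm_le_of_inner_le (loadNorm_nonneg S f hd hΩb) fun w => ?_
    rw [hg]
    exact le_of_abs_le (hload w)

/-- Unique solvability in the ball and convergence of the Zarantonello iteration. -/
theorem exists_solution {C : ℝ} (hC0 : 0 < C) (hC : IsConvectionBound Ω C) {σ ν : ℝ}
    (hσ : 0 ≤ σ) (hν : 0 < ν) {n : ℕ} (hn : 1 ≤ n) {R L : ℝ} (hR : 0 < R)
    (hF : 2 * (√2 * C) * loadNorm S f < ν ^ 2)
    (hFR : √2 * C * loadNorm S f ≤ 2 * (√2 * C * R * (ν - √2 * C * R)))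
    (hL : σ * n + 2 * ν + 2 * (√2 * C * R) ≤ L) :
    ∃ Usol ∈ ball S R,
      (∀ V ∈ divFreeSpace S, binghamOp σ ν n f Usol V = 0) ∧
      (∀ U ∈ ball S R, (∀ V ∈ divFreeSpace S, binghamOp σ ν n f U V = 0) → U = Usol) ∧
      ∀ δ : ℝ, 0 < δ → δ < 2 * (ν - √2 * C * R) / L ^ 2 →
        (∀ U ∈ divFreeSpace S, ∃! U' : FieldPair Ω, IsZarantonelloStep S σ ν n f δ U U') ∧
        ∀ u : ℕ → FieldPair Ω, u 0 ∈ ball S R →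
          (∀ l, IsZarantonelloStep S σ ν n f δ (u l) (u (l + 1))) →
          Tendsto (fun l => gradNorm (u l - Usol)) atTop (𝓝 0) := by
  obtain ⟨H, _, _, l, A, b, g, hY, hmem, hsym, hAb, hop, hg⟩ :=
    exists_representation S f hd hΩb hC0 hC hσ hν hn
  have hβ : 0 < √2 * C := hAb.beta_pos
  have hF0 := loadNorm_nonneg S f hd hΩb
  have hgF : √2 * C * ‖g‖ ≤ √2 * C * loadNorm S f := mul_le_mul_of_nonneg_left hg hβ.le
  obtain ⟨z, hz, huniq⟩ := hAb.existsUnique_zero (f := g) (by nlinarith)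
  have hin : ∀ w, l w ∈ divFreeSpace S := fun w => (hmem _).2 ⟨w, rfl⟩
  have hnorm : ∀ w, symNorm (l w) = ‖w‖ := fun w => by
    rw [symNorm_eq, norm_symLp_comp hsym]
  have hzero : ∀ w, (∀ V ∈ divFreeSpace S, binghamOp σ ν n f (l w) V = 0) →
      A w + b w w - g = 0 := fun w hw =>
    ext_inner_right ℝ fun v => by rw [hop, hw _ (hin v), inner_zero_left]
  -- From 2ν‖z‖ ≤ F ≤ 2R(ν - βR) ≤ 2νR.
  have hzR : ‖z‖ ≤ R := by
    have h1 := (hAb.bound_frozen hz).trans hg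
    have h2 := mul_le_mul_of_nonneg_left h1 hβ.le
    have h3 : 0 ≤ √2 * C * R * (√2 * C * R) := by positivity
    refine le_of_mul_le_mul_left (a := √2 * C * (2 * ν)) ?_ (by positivity)
    linarith
  -- The inner product of H is that of the symmetric gradients, so the implicit variational step
  -- becomes an explicit formula; existence and uniqueness of the iterate follow.
  have hstep : ∀ (δ : ℝ) (u w : H), IsZarantonelloStep S σ ν n f δ (l u) (l w) ↔
      w = u - δ • (A u + b u u - g) := by
    intro δ u w
    have hI : ∀ v w, symInner (l v) (l w) = inner ℝ v w := fun v w => by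
      rw [symInner_eq, hsym]
    constructor
    · rintro ⟨-, h⟩
      refine ext_inner_right ℝ fun v => ?_
      rw [inner_sub_left, real_inner_smul_left, hop, ← hI, ← hI]
      exact h _ (hin v)
    · intro h
      refine ⟨hin w, fun V hV => ?_⟩
      obtain ⟨v, rfl⟩ := (hmem V).1 hV
      rw [hI, hI, h, inner_sub_left, real_inner_smul_left, hop]
  refine ⟨l z, ⟨hin z, (hnorm z).trans_le hzR⟩, fun V hV => ?_, fun U hU h => ?_,
    fun δ hδ hδL => ⟨fun U hU => ?_, fun u hu0 hu => ?_⟩⟩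
  · obtain ⟨v, rfl⟩ := (hmem V).1 hV
    rw [← hop, hz, inner_zero_left]
  · obtain ⟨v, rfl⟩ := (hmem U).1 hU.1
    rw [huniq v (hzero v h)]
  · obtain ⟨v, rfl⟩ := (hmem U).1 hU
    refine ⟨l (v - δ • (A v + b v v - g)), (hstep _ _ _).2 rfl, fun U' hU' => ?_⟩
    obtain ⟨w, rfl⟩ := (hmem U').1 hU'.1
    rw [(hstep _ _ _).1 hU']
  · have hud : ∀ k, u k ∈ divFreeSpace S := fun k => by
      cases k with
      | zero => exact hu0.1
      | succ k => exact (hu k).1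
    choose y hy using fun k => (hmem _).1 (hud k)
    obtain rfl : (fun k => l (y k)) = u := funext hy
    have hL0 : 0 < L := lt_of_lt_of_le (by positivity) hL
    -- In the degenerate case ν_F = 0 no step size is admissible; the mere existence of δ excludes
    -- it.
    have hνF : √2 * C * R < ν := by
      by_contra hc
      have : 2 * (ν - √2 * C * R) / L ^ 2 ≤ 0 :=
        div_nonpos_of_nonpos_of_nonneg (by linarith) (sq_nonneg L)
      linarith
    have h := hAb.tendsto_iterate hg hz hzR hR hνF hFR hL hδ hδL (u := y)
      ((hnorm _).symm.trans_le hu0.2) fun k => (hstep _ _ _).1 (hu k)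
    have h2 := h.const_mul √2
    rw [mul_zero] at h2
    refine squeeze_zero (fun k => Real.sqrt_nonneg _) (fun k => ?_) h2
    have h3 := norm_snd_le (divFreeSpace_subset S (hin (y k - z)))
    rw [norm_symLp_comp hsym, l.map_sub, ← gradNorm_eq] at h3
    exact h3

end Solve

end Bingham

theorem mainTheorem3 (d : ℕ) (hd : d = 2 ∨ d = 3) (Ω : Set (Bingham.Vec d))
    (hΩ : IsOpen Ω) (hΩb : Bornology.IsBounded Ω) :
    (∃ C : ℝ, 0 < C ∧ Bingham.IsConvectionBound Ω C) ∧
    ∀ C : ℝ, 0 < C → Bingham.IsConvectionBound Ω C →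
    ∀ (T : Bingham.Triangulation Ω) (S : Bingham.LocalSpaces T)
      (f : MeasureTheory.Lp (Bingham.Vec d) 2 (MeasureTheory.volume.restrict Ω))
      (σ ν : ℝ) (n : ℕ), 0 ≤ σ → 0 < ν → 1 ≤ n →
      Bingham.loadNorm S f < ν ^ 2 / (2 * √2 * C) →
    ∀ R : ℝ, 0 < R →
      (ν - √(ν ^ 2 - 2 * √2 * C * Bingham.loadNorm S f)) / (2 * √2 * C) ≤ R →
      R ≤ (ν + √(ν ^ 2 - 2 * √2 * C * Bingham.loadNorm S f)) / (2 * √2 * C) →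
    ∀ νF LF : ℝ, νF = ν - √2 * C * R → LF = √3 * σ * n + 2 * ν + 2 * √2 * C * R →
      -- sign of the monotonicity constant
      0 ≤ νF ∧ (0 < Bingham.loadNorm S f ∨ R < ν / (√2 * C) → 0 < νF) ∧
      -- strong monotonicity
      (∀ U ∈ Bingham.ball S R, ∀ V ∈ Bingham.ball S R,
        νF * Bingham.gradNorm (U - V) ^ 2 ≤
          Bingham.binghamOp σ ν n f U (U - V) - Bingham.binghamOp σ ν n f V (U - V)) ∧
      -- Lipschitz continuity
      (∀ U ∈ Bingham.ball S R, ∀ V ∈ Bingham.ball S R, ∀ W ∈ Bingham.divFreeSpace S,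
        |Bingham.binghamOp σ ν n f U W - Bingham.binghamOp σ ν n f V W| ≤
          LF * Bingham.gradNorm (U - V) * Bingham.gradNorm W) ∧
      -- unique solvability in the ball and convergence of the iteration
      ∃ Usol ∈ Bingham.ball S R,
        (∀ V ∈ Bingham.divFreeSpace S, Bingham.binghamOp σ ν n f Usol V = 0) ∧
        (∀ U ∈ Bingham.ball S R,
          (∀ V ∈ Bingham.divFreeSpace S, Bingham.binghamOp σ ν n f U V = 0) → U = Usol) ∧
        ∀ δ : ℝ, 0 < δ → δ < 2 * νF / LF ^ 2 →
          (∀ U ∈ Bingham.divFreeSpace S, ∃! U' : Bingham.FieldPair Ω,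
            Bingham.IsZarantonelloStep S σ ν n f δ U U') ∧
          ∀ u : ℕ → Bingham.FieldPair Ω, u 0 ∈ Bingham.ball S R →
            (∀ l, Bingham.IsZarantonelloStep S σ ν n f δ (u l) (u (l + 1))) →
            Filter.Tendsto (fun l => Bingham.gradNorm (u l - Usol)) Filter.atTop (nhds 0) := by
  refine ⟨Bingham.exists_isConvectionBound hd hΩb, ?_⟩
  intro C hC0 hC T S f σ ν n hσ hν hn hF R hR hlo hhi νF LF hνF hLF
  subst hνF hLF
  have hβ : 0 < √2 * C := by positivity
  have hF0 := Bingham.loadNorm_nonneg S f hd hΩb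
  rw [mul_assoc, lt_div_iff₀ (by positivity)] at hF
  rw [mul_assoc 2] at hlo hhi
  obtain ⟨h1, h2⟩ := Bingham.radius_facts hβ hν hF0 (by linarith) hlo hhi
  refine ⟨by linarith, ?_, fun U hU V hV =>
    Bingham.binghamOp_strongly_monotone hd hΩb hC0 hC hσ hν hn hU hV, fun U hU V hV W hW =>
    Bingham.abs_binghamOp_sub_le hd hΩb hC0 hC hσ hν hn hU hV hW,
    Bingham.exists_solution S f hd hΩb hC0 hC hσ hν hn hR (by linarith) h2 ?_⟩
  · rintro (h | h)
    -- If ν_F were 0, the radius inequality would force √2 * C times the dual norm to be at most 0.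
    · refine lt_of_le_of_ne (by linarith) fun h0 => ?_
      rw [← h0, mul_zero, mul_zero] at h2
      exact absurd (mul_pos hβ h) (not_lt.2 h2)
    · rw [lt_div_iff₀ hβ] at h
      linarith
  · have h3 : σ * n ≤ √3 * (σ * n) :=
      le_mul_of_one_le_left (by positivity) (Real.one_le_sqrt.2 (by norm_num))
    linarith
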